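/- **Setting.** Let $X$ be a real Banach space, $\mathbb R_+=[0,\infty)$. *Gaussian spaces.* Let $(\gamma_n)_{n\ge1}$ be independent real standard Gaussian random variables. $\gamma(\mathbb R_+;X)$ is the completion of the finite rank operators $T=\sum_{n=1}^N h_n\otimes x_n:L^2(\mathbb R_+)\to X$ ($(h_n)$ orthonormal in the real Hilbert space $L^2(\mathbb R_+)$, $x_n\in X$) in the norm $\|T\|_{\gamma(\mathbb R_+;X)}=\big(\mathbb E\|\sum_{n=1}^N\gamma_nx_n\|^2\big)^{1/2}$. It is identified with a space of bounded operators $L^2(\mathbb R_+)\to X$, namely the closure of the finite rank operators in the norm $\|T\|_{\gamma(\mathbb R_+;X)}=\sup\big(\mathbb E\|\sum_{n=1}^N\gamma_nTh_n\|^2\big)^{1/2}$, the supremum being over all finite orthonormal systems $(h_n)_{n=1}^N$ in $L^2(\mathbb R_+)$. A strongly measurable $f:\mathbb R_+\to X$ that is Bochner integrable on sets of finite measure belongs to $\gamma(\mathbb R_+;X)$ if $\mathbf 1_F\mapsto\int_Ff\,dt$ ($F\subseteq\mathbb R_+$ measurable, $|F|<\infty$) extends to a bounded operator on $L^2(\mathbb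 R_+)$ that belongs to $\gamma(\mathbb R_+;X)$; then $\|f\|_{\gamma(\mathbb R_+;X)}$ is the norm of that operator. For $f\in\gamma(\mathbb R_+;X)$ and $x^*\in X^*$ put $\langle f,x^*\rangle:=f^*x^*\in L^2(\mathbb R_+)$. *Sectorial operators.* For $\sigma\in(0,\pi)$ let $\Sigma_\sigma=\{z\in\mathbb C\setminus\{0\}:|\arg z|<\sigma\}$. A closed densely defined linear operator $A$ on $X$ is *sectorial of type $\sigma$* if it is injective, has dense range, the spectrum of (the complexification of) $A$ is contained in $\overline{\Sigma_\sigma}$, and for every $\sigma'\in(\sigma,\pi)$ the operators $z(z-A)^{-1}$, $z\ne0$, $|\arg z|>\sigma'$, are uniformly bounded. $A$ is *sectorial* if it is so of some type $\sigma\in(0,\pi)$, and its *angle* is the infimum of all such $\sigma$. *Maximal $\gamma$-regularity.* Let $A$ be sectorial of angle $<\pi/2$ and let $S$ be the strongly continuous semigroup generated by $-A$. $A$ has *maximal $\gamma$-regularity* if there is a constant $C$ such that for every $f\in C_c^\infty((0,\infty);D(A))$ ($D(A)$ with the graph norm) the function $u(t)=\int_0^tS(t-s)f(s)\,ds$ takes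 values in $D(A)$ and satisfies $Au\in\gamma(\mathbb R_+;X)$ and $\|Au\|_{\gamma(\mathbb R_+;X)}\le C\|f\|_{\gamma(\mathbb R_+;X)}$. *Weak solutions.* For $f\in\gamma(\mathbb R_+;X)$, a *weak solution* of $$u'+Au=f\ \text{ on }\mathbb R_+,\qquad u(0)=0,$$ is a function $u:\mathbb R_+\to X$, integrable on $[0,T]$ for every $T<\infty$, such that $u(0)=0$ and, for all $t\in(0,\infty)$ and $x^*\in D(A^*)$, $$\langle u(t),x^*\rangle+\int_0^t\langle u(s),A^*x^*\rangle\,ds=\int_0^t\langle f,x^*\rangle(s)\,ds .$$ **Proposition.** Let $A$ be a sectorial operator of angle $<\pi/2$ on $X$. If $A$ has maximal $\gamma$-regularity, then for every $f\in\gamma(\mathbb R_+;X)$ there is a unique weak solution $u:\mathbb R_+\to X$ of the above problem. For every $T\ge0$ it belongs to $C([0,T];X)$, and there is a constant $C\ge0$, independent of $f$ and $T$, such that for all $f\in\gamma(\mathbb R_+;X)$ and all $T\ge0$ $$\|u\|_{C([0,T];X)}=\sup_{t\in[0,T]}\|u(t)\|\le C\sqrt T\,\|f\|_{\gamma(\mathbb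 R_+;X)} .$$ -/

import Mathlib

open MeasureTheory ProbabilityTheory Filter Topology
open scoped ENNReal NNReal ContDiff

noncomputable section

namespace GammaReg

/-! ### The operator ideal `γ(H, X)` -/

section Gamma

variable {H X : Type*} [NormedAddCommGroup H] [InnerProductSpace ℝ H]
  [NormedAddCommGroup X] [NormedSpace ℝ X]

/-- `(𝔼 ‖∑ γₙ xₙ‖²)^{1/2}` for independent real standard Gaussian variables `γₙ`. -/
def gaussianSumENorm {N : ℕ} (x : Fin N → X) : ℝ≥0∞ :=
  (∫⁻ g : Fin N → ℝ, ‖∑ n, g n • x n‖ₑ ^ 2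
    ∂(Measure.pi fun _ : Fin N => gaussianReal 0 1)) ^ (1 / 2 : ℝ)

/-- The `γ`-norm of a bounded operator `T : H → X` (possibly infinite): the supremum of
`(𝔼 ‖∑ γₙ T hₙ‖²)^{1/2}` over all finite orthonormal systems `(hₙ)`. If `T = ∑ hₙ ⊗ xₙ` has
finite rank, with `(hₙ)` orthonormal, then it equals `(𝔼 ‖∑ γₙ xₙ‖²)^{1/2}`. -/
def gammaENorm (T : H →L[ℝ] X) : ℝ≥0∞ :=
  ⨆ (N : ℕ) (h : Fin N → H) (_ : Orthonormal ℝ h), gaussianSumENorm fun n => T (h n)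

/-- `T = ∑ hₙ ⊗ xₙ` with `(hₙ)` orthonormal, where `h ⊗ x` is the operator `h' ↦ ⟨h', h⟩ x`. -/
def IsFiniteRank (T : H →L[ℝ] X) : Prop :=
  ∃ (N : ℕ) (h : Fin N → H) (x : Fin N → X), Orthonormal ℝ h ∧
    T = ∑ n, (innerSL ℝ (h n)).smulRight (x n)

/-- `T ∈ γ(H, X)`: `T` is a limit of finite rank operators in the `γ`-norm. Since the `γ`-norm
dominates the operator norm and the operators of finite `γ`-norm are complete for it, this is the
completion of the finite rank operators, realised inside the bounded operators. -/
def MemGamma (T : H →L[ℝ] X) : Prop :=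
  ∀ ε : ℝ≥0∞, 0 < ε → ∃ R : H →L[ℝ] X, IsFiniteRank R ∧ gammaENorm (T - R) < ε

end Gamma

/-- The function `f` induces the operator `T` on `L²(E, ν)`: `f` is strongly measurable, Bochner
integrable on every set `F` of finite measure, and `T 1_F = ∫_F f dν`. -/
def Induces {E X : Type*} [MeasurableSpace E] [NormedAddCommGroup X] [NormedSpace ℝ X]
    (ν : Measure E) (f : E → X) (T : Lp ℝ 2 ν →L[ℝ] X) : Prop :=
  AEStronglyMeasurable f ν ∧
    ∀ (F : Set E) (hF : MeasurableSet F) (hν : ν F ≠ ⊤),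
      IntegrableOn f F ν ∧ T (indicatorConstLp 2 hF hν (1 : ℝ)) = ∫ s in F, f s ∂ν

/-- The real Hilbert space `L²(ℝ₊)`, where `ℝ₊ = [0, ∞)`. -/
abbrev L2Half : Type := Lp ℝ 2 (volume.restrict (Set.Ici (0 : ℝ)))

variable {X : Type*} [NormedAddCommGroup X] [NormedSpace ℝ X]

/-- For `T ∈ γ(ℝ₊; X)` and a functional `φ`, the element `⟨T, φ⟩ = T* φ` of `L²(ℝ₊)`, through the
Riesz representation theorem. -/
def pairing (T : L2Half →L[ℝ] X) (φ : X →L[ℝ] ℝ) : L2Half :=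
  (InnerProductSpace.toDual ℝ L2Half).symm (φ ∘L T)

/-! ### Sectorial operators -/

/-- The open sector `Σ_θ`. -/
def sector (θ : ℝ) : Set ℂ := {z | z ≠ 0 ∧ |z.arg| < θ}

/-- Multiplication by the complex number `z` on the complexification `X ⊕ iX` of the real space
`X`, whose elements are written as pairs. -/
def complexSMul (z : ℂ) (p : X × X) : X × X :=
  (z.re • p.1 - z.im • p.2, z.im • p.1 + z.re • p.2)

/-- The operator `z - A` of the complexification of `A`, with domain `D(A) ⊕ iD(A)`. -/
def complexShift (A : X →ₗ.[ℝ] X) (z : ℂ) (p : A.domain × A.domain) : X × X :=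
  complexSMul z ((p.1 : X), (p.2 : X)) - (A p.1, A p.2)

/-- The complex numbers `z` for which (the complexification of) `z - A` has a bounded inverse,
defined everywhere. On `X ⊕ iX` the maximum norm is used; it is equivalent to each of the usual
norms of a complexification. -/
def resolventSet (A : X →ₗ.[ℝ] X) : Set ℂ :=
  {z | Function.Bijective (complexShift A z) ∧
    ∃ M : ℝ, ∀ p : A.domain × A.domain, ‖((p.1 : X), (p.2 : X))‖ ≤ M * ‖complexShift A z p‖}

/-- The spectrum of (the complexification of) `A`. -/
def operatorSpectrum (A : X →ₗ.[ℝ] X) : Set ℂ := (resolventSet A)ᶜ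

/-- `A` is sectorial of type `σ ∈ (0, π)`. The last field says that for `σ' ∈ (σ, π)` the
operators `z (z - A)⁻¹`, `|arg z| > σ'`, are uniformly bounded. -/
structure IsSectorialOfType (A : X →ₗ.[ℝ] X) (σ : ℝ) : Prop where
  pos : 0 < σ
  lt_pi : σ < Real.pi
  closed : A.IsClosed
  dense_domain : Dense (A.domain : Set X)
  injective : Function.Injective A
  dense_range : Dense (Set.range A)
  spectrum_subset : operatorSpectrum A ⊆ closure (sector σ)
  bound : ∀ σ' : ℝ, σ < σ' → σ' < Real.pi → ∃ M : ℝ, ∀ z : ℂ, z ≠ 0 → σ' < |z.arg| →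
    ∀ p : A.domain × A.domain, ‖z‖ * ‖((p.1 : X), (p.2 : X))‖ ≤ M * ‖complexShift A z p‖

/-- `A` is sectorial (of some type). -/
def IsSectorial (A : X →ₗ.[ℝ] X) : Prop := ∃ σ : ℝ, IsSectorialOfType A σ

/-- The sectoriality angle of `A`. -/
def sectorialityAngle (A : X →ₗ.[ℝ] X) : ℝ := sInf {σ : ℝ | IsSectorialOfType A σ}

/-! ### Semigroups, maximal regularity, weak solutions -/

/-- `(S(t))_{t ≥ 0}` is a strongly continuous semigroup with generator `-A` (equality of domains
included). The values `S t` for `t < 0` play no role. -/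
structure IsSemigroupOfNeg (S : ℝ → X →L[ℝ] X) (A : X →ₗ.[ℝ] X) : Prop where
  map_zero : S 0 = ContinuousLinearMap.id ℝ X
  map_add : ∀ s t : ℝ, 0 ≤ s → 0 ≤ t → S (s + t) = S s ∘L S t
  continuousOn : ∀ x : X, ContinuousOn (fun t => S t x) (Set.Ici 0)
  generator : ∀ x y : X, (x, y) ∈ A.graph ↔
    Tendsto (fun t : ℝ => t⁻¹ • (S t x - x)) (𝓝[>] 0) (𝓝 (-y))

/-- `f ∈ C_c^∞((0, ∞); D(A))`, where `D(A)` carries the graph norm: both `f` and `A f` are smooth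
as functions into `X`. -/
structure IsTestFunction (A : X →ₗ.[ℝ] X) (f : ℝ → A.domain) : Prop where
  smooth : ContDiff ℝ ∞ fun t => (f t : X)
  smooth_apply : ContDiff ℝ ∞ fun t => A (f t)
  compact_support : HasCompactSupport fun t => (f t : X)
  support_subset : tsupport (fun t => (f t : X)) ⊆ Set.Ioi 0

/-- The convolution `(S * f)(t) = ∫₀ᵗ S(t - s) f(s) ds`. -/
def convolution (S : ℝ → X →L[ℝ] X) (f : ℝ → X) (t : ℝ) : X :=
  ∫ s in (0 : ℝ)..t, S (t - s) (f s)

/-- Maximal `γ`-regularity: if `S` is the semigroup generated by `-A`, then there is a constant `C`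
such that for all `f ∈ C_c^∞((0, ∞); D(A))` the convolution `u = S * f` takes values in `D(A)` and
`A u =: v` belongs to `γ(ℝ₊; X)`, with `‖A u‖_γ ≤ C ‖f‖_γ`. Here `Tf` and `Tv` are the operators
on `L²(ℝ₊)` induced by `f` and `v`. -/
def HasMaximalGammaRegularity (A : X →ₗ.[ℝ] X) : Prop :=
  ∀ S : ℝ → X →L[ℝ] X, IsSemigroupOfNeg S A →
    ∃ C : ℝ≥0, ∀ f : ℝ → A.domain, IsTestFunction A f →
      ∀ Tf : L2Half →L[ℝ] X, Induces (volume.restrict (Set.Ici 0)) (fun t => (f t : X)) Tf →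
        ∃ (v : ℝ → X) (Tv : L2Half →L[ℝ] X),
          (∀ t : ℝ, 0 ≤ t → (convolution S (fun s => (f s : X)) t, v t) ∈ A.graph) ∧
          Induces (volume.restrict (Set.Ici 0)) v Tv ∧ MemGamma Tv ∧
          gammaENorm Tv ≤ C * gammaENorm Tf

/-- `φ ∈ D(A*)` and `A* φ = ψ`. -/
def IsAdjointPair (A : X →ₗ.[ℝ] X) (φ ψ : X →L[ℝ] ℝ) : Prop :=
  ∀ x : A.domain, φ (A x) = ψ (x : X)

/-- `u : ℝ₊ → X` is a weak solution of `u' + A u = T`, `u(0) = 0`, where `T ∈ γ(ℝ₊; X)`. The values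
`u t` for `t < 0` play no role. -/
structure IsWeakSolution (A : X →ₗ.[ℝ] X) (T : L2Half →L[ℝ] X) (u : ℝ → X) : Prop where
  locally_integrable : ∀ t : ℝ, IntegrableOn u (Set.Icc 0 t)
  initial : u 0 = 0
  equation : ∀ t : ℝ, 0 < t → ∀ φ ψ : X →L[ℝ] ℝ, IsAdjointPair A φ ψ →
    φ (u t) + ∫ s in (0 : ℝ)..t, ψ (u s) = ∫ s in (0 : ℝ)..t, pairing T φ s

end GammaReg

end

/-!
Let `T ∈ γ(ℝ₊; X)` be the datum. For a test function `f ∈ C_c^∞((0, ∞)) ⊗ D(A)` the convolution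
`u = S * f` solves `u' = f - A u` (`hasDerivWithinAt_convolution`), so that `u(t)` is the value at
`1_{(0, t]}` of the operator induced by `f - A u` (`convolution_eq_apply`). The `γ`-norm dominates the
operator norm, `1_{(0, t]}` has norm `√t` in `L²`, and maximal `γ`-regularity bounds the `γ`-norm of
`f - A u` by `(1 + C) ‖f‖_γ`; this is the estimate `enorm_convolution_le`. Operators induced by test
functions are dense in `γ(ℝ₊; X)` (`MemGamma.exists_approx`, `dense_smoothHalf`,
`exists_isTestFunction`), and the estimate, applied to differences, makes the solutions converge
locally uniformly to a weak solution (`exists_isWeakSolution`).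

For uniqueness, the second primitive `w` of the difference of two weak solutions takes values in
`D(A)`, by closedness of `A` and the Hahn–Banach theorem, and is a classical solution of `w' = -A w`,
`w(0) = 0`. Hence `s ↦ S(t - s) w(s)` is constant, and `w = 0` (`IsWeakSolution.eqOn`).

Both parts need the semigroup `S`. It is constructed by the Hille–Yosida argument
(`IsResolventSeq.exists_semigroup`), for which the operators `Q = l (l + A)⁻¹`, `l > 0`, have to be
power bounded uniformly in `l`. As the right half-plane consists of regular points of `-A`, formally
`(1 - w Q)⁻¹ = 1 + w l (l (1 - w) + A)⁻¹` is holomorphic for `‖w‖ < 1` and bounded by a multiple of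
`1 / ‖1 - w‖`. The coefficients of `(1 - w Q)⁻²` are `(n + 1) Q ^ n`; the Cauchy formula on the circle of
radius `n / (n + 1)` and the integral of the Poisson kernel bound them by a multiple of `n + 1`
(`IsRittResolvent.norm_pow_le`). The complexification is used only through real-linear operators on
`X × X` and scalar holomorphic functions.
-/

open MeasureTheory ProbabilityTheory Filter Topology
open scoped ENNReal NNReal ContDiff

noncomputable section

namespace GammaReg

/-! ### Power bounds from a resolvent condition of Ritt type -/

lemma one_sub_ne_zero_of_norm_lt_one {z : ℂ} (hz : ‖z‖ < 1) : 1 - z ≠ 0 := by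
  intro h
  have : z = 1 := (sub_eq_zero.1 h).symm
  simp [this] at hz

/-- The integral of the Poisson kernel, obtained from the Cauchy formula for `z ↦ 1 / (1 - z)` at
the point `r ^ 2`, because `conj z = r ^ 2 / z` on the circle `‖z‖ = r`. -/
lemma integral_inv_norm_one_sub_circleMap_sq {r : ℝ} (hr : 0 < r) (hr1 : r < 1) :
    ∫ θ in (0 : ℝ)..2 * Real.pi, (‖1 - circleMap 0 r θ‖ ^ 2)⁻¹ = 2 * Real.pi * (1 - r ^ 2)⁻¹ := by
  have hd : DifferentiableOn ℂ (fun z : ℂ => (1 - z)⁻¹) (Metric.closedBall 0 r) := by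
    intro z hz
    have hz' : ‖z‖ < 1 := lt_of_le_of_lt (by simpa using hz) hr1
    exact ((differentiableAt_const _).sub differentiableAt_id |>.inv
      (one_sub_ne_zero_of_norm_lt_one hz')).differentiableWithinAt
  have hmem : ((r : ℂ) ^ 2) ∈ Metric.ball (0 : ℂ) r := by
    simp only [mem_ball_zero_iff, norm_pow, Complex.norm_real, Real.norm_eq_abs, abs_of_pos hr]
    nlinarith
  have key := hd.circleIntegral_sub_inv_smul hmem
  have hI : (∫ θ in (0 : ℝ)..2 * Real.pi,
      Complex.I * (((‖1 - circleMap 0 r θ‖ ^ 2)⁻¹ : ℝ) : ℂ)) =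
      (2 * Real.pi * Complex.I : ℂ) • (1 - (r : ℂ) ^ 2)⁻¹ := by
    rw [← key, circleIntegral]
    refine intervalIntegral.integral_congr fun θ _ => ?_
    simp only [deriv_circleMap, smul_eq_mul, Complex.ofReal_inv, Complex.ofReal_pow]
    set z := circleMap 0 r θ with hz
    have hnz : ‖z‖ = r := by simp [hz, abs_of_pos hr]
    have hz0 : z ≠ 0 := by rw [← norm_pos_iff, hnz]; exact hr
    have h1 : 1 - z ≠ 0 := one_sub_ne_zero_of_norm_lt_one (hnz.trans_lt hr1)
    have hr2 : (r : ℂ) ^ 2 = z * (starRingEnd ℂ) z := by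
      rw [Complex.mul_conj, Complex.normSq_eq_norm_sq, hnz]; push_cast; rfl
    have h2 : 1 - (starRingEnd ℂ) z ≠ 0 :=
      one_sub_ne_zero_of_norm_lt_one (by rw [Complex.norm_conj, hnz]; exact hr1)
    have h3 : ((‖1 - z‖ : ℂ)) ^ 2 = (1 - z) * (1 - (starRingEnd ℂ) z) := by
      have := Complex.mul_conj (1 - z)
      rw [Complex.normSq_eq_norm_sq] at this
      rw [← Complex.ofReal_pow, ← this]; simp
    rw [h3, hr2]
    have h4 : z - z * (starRingEnd ℂ) z ≠ 0 := by
      rw [← mul_one_sub]; exact mul_ne_zero hz0 h2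
    field_simp
  rw [intervalIntegral.integral_const_mul, intervalIntegral.integral_ofReal] at hI
  have hI' : ((∫ θ in (0 : ℝ)..2 * Real.pi, (‖1 - circleMap 0 r θ‖ ^ 2)⁻¹ : ℝ) : ℂ) =
      ((2 * Real.pi * (1 - r ^ 2)⁻¹ : ℝ) : ℂ) := by
    apply mul_left_cancel₀ Complex.I_ne_zero
    rw [hI]; push_cast; simp only [smul_eq_mul]; ring
  exact_mod_cast hI'

/-- Cauchy's formula for the coefficient of `z ^ n`, on a circle inside the unit disc, for a function
given by a finite Taylor expansion. -/
lemma circleIntegral_taylor {h g : ℂ → ℂ} {c : ℕ → ℂ} {n : ℕ} {r : ℝ} (hr : 0 < r) (hr1 : r < 1)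
    (hg : DifferentiableOn ℂ g (Metric.ball 0 1))
    (hexp : ∀ z : ℂ, ‖z‖ < 1 → h z = ∑ k ∈ Finset.range (n + 1), c k * z ^ k + z ^ (n + 1) * g z) :
    (∮ z in C(0, r), (z ^ (n + 1))⁻¹ * h z) = 2 * Real.pi * Complex.I * c n := by
  have hsub : Metric.closedBall (0 : ℂ) r ⊆ Metric.ball 0 1 :=
    Metric.closedBall_subset_ball hr1
  have hg0 : (∮ z in C(0, r), g z) = 0 :=
    (hg.mono hsub |>.diffContOnCl_ball (Set.Subset.rfl)).circleIntegral_eq_zero hr.le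
  have hne : ∀ z ∈ Metric.sphere (0 : ℂ) r, z ≠ 0 := by
    rintro z hz rfl; simp at hz; exact hr.ne hz
  have hcg : CircleIntegrable g 0 r :=
    (hg.continuousOn.mono (Metric.sphere_subset_closedBall.trans hsub)).circleIntegrable hr.le
  have hck : ∀ k : ℕ, CircleIntegrable (fun z => c k * (z - 0) ^ ((k : ℤ) - (n + 1))) 0 r := by
    intro k
    refine ContinuousOn.circleIntegrable hr.le (continuousOn_const.mul ?_)
    intro z hz
    exact ((continuousAt_id.sub continuousAt_const).zpow₀ _
      (Or.inl (by simpa using hne z hz))).continuousWithinAt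
  have hcong : (∮ z in C(0, r), (z ^ (n + 1))⁻¹ * h z) =
      ∮ z in C(0, r), ((∑ k ∈ Finset.range (n + 1), c k * (z - 0) ^ ((k : ℤ) - (n + 1))) + g z) := by
    refine circleIntegral.integral_congr hr.le fun z hz => ?_
    have hz0 := hne z hz
    have hz1 : ‖z‖ < 1 := by
      have : ‖z‖ = r := by simpa using hz
      rw [this]; exact hr1
    simp only [hexp z hz1, mul_add, Finset.mul_sum, sub_zero]
    congr 1
    · refine Finset.sum_congr rfl fun k _ => ?_
      rw [zpow_sub₀ hz0]
      norm_cast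
      field_simp
    · field_simp
  rw [hcong, circleIntegral.integral_add (CircleIntegrable.fun_sum _ fun k _ => hck k) hcg, hg0,
    add_zero, circleIntegral.integral_fun_sum fun k _ => hck k]
  rw [Finset.sum_eq_single n]
  · rw [circleIntegral.integral_const_mul]
    have : ((n : ℤ) - (n + 1)) = -1 := by ring
    simp only [this, zpow_neg_one]
    rw [circleIntegral.integral_sub_center_inv _ hr.ne']
    ring
  · intro k _ hk
    rw [circleIntegral.integral_const_mul, circleIntegral.integral_sub_zpow_of_ne (by omega),
      mul_zero]
  · simp

/-- Coefficients of a holomorphic function on the disc that is dominated by `‖1 - z‖ ^ (-2)` grow at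
most linearly: the Cauchy formula on the circle of radius `n / (n + 1)`. -/
lemma norm_coeff_le {h g : ℂ → ℂ} {c : ℕ → ℂ} {n : ℕ} (hn : 1 ≤ n) {M : ℝ}
    (hg : DifferentiableOn ℂ g (Metric.ball 0 1))
    (hexp : ∀ z : ℂ, ‖z‖ < 1 → h z = ∑ k ∈ Finset.range (n + 1), c k * z ^ k + z ^ (n + 1) * g z)
    (hM : ∀ z : ℂ, ‖z‖ < 1 → ‖h z‖ ≤ M * (‖1 - z‖ ^ 2)⁻¹) :
    ‖c n‖ ≤ Real.exp 1 * M * (n + 1) := by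
  have hn0 : (0 : ℝ) < n := by exact_mod_cast hn
  set r : ℝ := n / (n + 1) with hrdef
  have hr : 0 < r := by positivity
  have hr1 : r < 1 := by rw [hrdef, div_lt_one (by positivity)]; linarith
  have hM0 : 0 ≤ M := by
    have := (norm_nonneg _).trans (hM 0 (by simp)); simpa using this
  have key := circleIntegral_taylor hr hr1 hg hexp
  have hzr : ∀ θ, ‖circleMap 0 r θ‖ = r := fun θ => by simp [abs_of_pos hr]
  have hbd : ‖∮ z in C(0, r), (z ^ (n + 1))⁻¹ * h z‖ ≤
      r⁻¹ ^ n * M * (2 * Real.pi * (1 - r ^ 2)⁻¹) := by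
    rw [← integral_inv_norm_one_sub_circleMap_sq hr hr1, ← intervalIntegral.integral_const_mul]
    rw [circleIntegral]
    refine intervalIntegral.norm_integral_le_of_norm_le (by positivity) ?_ ?_
    · refine Eventually.of_forall fun θ _ => ?_
      rw [deriv_circleMap, norm_smul, norm_mul, norm_mul, norm_inv, norm_pow, hzr, Complex.norm_I]
      have h1 := hM (circleMap 0 r θ) (by rw [hzr]; exact hr1)
      calc r * 1 * ((r ^ (n + 1))⁻¹ * ‖h (circleMap 0 r θ)‖)
          = r⁻¹ ^ n * ‖h (circleMap 0 r θ)‖ := by rw [inv_pow, pow_succ]; field_simp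
        _ ≤ r⁻¹ ^ n * (M * (‖1 - circleMap 0 r θ‖ ^ 2)⁻¹) := by gcongr
        _ = _ := by ring
    · refine Continuous.intervalIntegrable ?_ _ _
      refine continuous_const.mul (Continuous.inv₀ (by fun_prop) fun θ => ?_)
      have := one_sub_ne_zero_of_norm_lt_one ((hzr θ).trans_lt hr1)
      positivity
  rw [key, norm_mul] at hbd
  have hpi : ‖(2 * Real.pi * Complex.I : ℂ)‖ = 2 * Real.pi := by
    simp [Real.pi_pos.le]
  rw [hpi] at hbd
  have hcn : ‖c n‖ ≤ r⁻¹ ^ n * M * (1 - r ^ 2)⁻¹ := by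
    have := Real.pi_pos
    refine le_of_mul_le_mul_left (hbd.trans_eq ?_) (by positivity : 0 < 2 * Real.pi)
    ring
  refine hcn.trans ?_
  have h1 : r⁻¹ ^ n ≤ Real.exp 1 := by
    have : r⁻¹ = 1 + 1 / n := by rw [hrdef]; field_simp
    rw [this]
    have h2 : (1 : ℝ) + 1 / n ≤ Real.exp (1 / n) := by
      linarith [Real.add_one_le_exp (1 / (n : ℝ))]
    calc (1 + 1 / (n : ℝ)) ^ n ≤ Real.exp (1 / n) ^ n := by gcongr
      _ = Real.exp 1 := by rw [← Real.exp_nat_mul]; congr 1; field_simp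
  have h2 : (1 - r ^ 2)⁻¹ ≤ (n : ℝ) + 1 := by
    have h3 : (n + 1 : ℝ)⁻¹ ≤ 1 - r ^ 2 := by
      have : (n + 1 : ℝ)⁻¹ = 1 - r := by rw [hrdef]; field_simp; ring
      nlinarith
    calc (1 - r ^ 2)⁻¹ ≤ ((n + 1 : ℝ)⁻¹)⁻¹ := inv_anti₀ (by positivity) h3
      _ = n + 1 := inv_inv _
  have h3 : 0 ≤ (1 - r ^ 2)⁻¹ := inv_nonneg.2 (by nlinarith)
  gcongr

section Complexification

variable {X : Type*} [NormedAddCommGroup X] [NormedSpace ℝ X]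

/-- Multiplication by `z` as a bounded real-linear operator on the complexification `X × X`. -/
def complexSMulL (z : ℂ) : (X × X) →L[ℝ] (X × X) :=
  ContinuousLinearMap.prod
    (z.re • ContinuousLinearMap.fst ℝ X X - z.im • ContinuousLinearMap.snd ℝ X X)
    (z.im • ContinuousLinearMap.fst ℝ X X + z.re • ContinuousLinearMap.snd ℝ X X)

lemma complexSMulL_apply (z : ℂ) (p : X × X) : complexSMulL z p = complexSMul z p := rfl

lemma norm_complexSMul_le (z : ℂ) (p : X × X) : ‖complexSMul z p‖ ≤ 2 * ‖z‖ * ‖p‖ := by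
  have h1 : ‖p.1‖ ≤ ‖p‖ := norm_fst_le p
  have h2 : ‖p.2‖ ≤ ‖p‖ := norm_snd_le p
  have h3 : ‖z.re‖ ≤ ‖z‖ := Complex.abs_re_le_norm z
  have h4 : ‖z.im‖ ≤ ‖z‖ := Complex.abs_im_le_norm z
  have hm : ∀ (a : ℝ) (x : X), ‖a‖ ≤ ‖z‖ → ‖x‖ ≤ ‖p‖ → ‖a • x‖ ≤ ‖z‖ * ‖p‖ := by
    intro a x ha hx
    rw [norm_smul]
    exact mul_le_mul ha hx (norm_nonneg _) (norm_nonneg _)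
  refine max_le ?_ ?_
  · refine (norm_sub_le _ _).trans ?_
    linarith [hm _ _ h3 h1, hm _ _ h4 h2]
  · refine (norm_add_le _ _).trans ?_
    linarith [hm _ _ h4 h1, hm _ _ h3 h2]

lemma continuous_complexSMulL : Continuous (complexSMulL : ℂ → (X × X) →L[ℝ] (X × X)) := by
  have h : (complexSMulL : ℂ → (X × X) →L[ℝ] (X × X)) = fun z =>
      z.re • complexSMulL 1 + z.im • complexSMulL Complex.I := by
    funext z
    ext p <;> simp [complexSMulL]
  rw [h]
  fun_prop

/-- The complex-linear extension of a real functional to the complexification `X × X`. -/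
def complexFunctional (φ : X →L[ℝ] ℝ) : (X × X) →L[ℝ] ℂ :=
  Complex.ofRealCLM ∘L φ ∘L ContinuousLinearMap.fst ℝ X X +
    Complex.I • (Complex.ofRealCLM ∘L φ ∘L ContinuousLinearMap.snd ℝ X X)

lemma complexFunctional_apply (φ : X →L[ℝ] ℝ) (p : X × X) :
    complexFunctional φ p = (φ p.1 : ℂ) + Complex.I * (φ p.2 : ℂ) := rfl

lemma complexFunctional_complexSMul (φ : X →L[ℝ] ℝ) (z : ℂ) (p : X × X) :
    complexFunctional φ (complexSMul z p) = z * complexFunctional φ p := by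
  rw [complexFunctional_apply, complexFunctional_apply]
  apply Complex.ext <;> (simp [complexSMul]; try ring)

lemma norm_complexFunctional_le (φ : X →L[ℝ] ℝ) (p : X × X) :
    ‖complexFunctional φ p‖ ≤ 2 * ‖φ‖ * ‖p‖ := by
  rw [complexFunctional_apply]
  refine (norm_add_le _ _).trans ?_
  have h1 := (φ.le_opNorm p.1).trans (mul_le_mul_of_nonneg_left (norm_fst_le p) (norm_nonneg φ))
  have h2 := (φ.le_opNorm p.2).trans (mul_le_mul_of_nonneg_left (norm_snd_le p) (norm_nonneg φ))
  rw [norm_mul, Complex.norm_I, one_mul, Complex.norm_real, Complex.norm_real]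
  linarith

/-- The operator `1 - w Q` on the complexification. -/
def oneSubSMul (Q : X →L[ℝ] X) (w : ℂ) : (X × X) →L[ℝ] (X × X) :=
  1 - complexSMulL w * Q.prodMap Q

lemma commute_complexSMulL (Q : X →L[ℝ] X) (w : ℂ) : Commute (complexSMulL w) (Q.prodMap Q) := by
  ext p <;> simp [complexSMulL]

lemma complexSMulL_mul_comm (w z : ℂ) :
    Commute (complexSMulL w : (X × X) →L[ℝ] (X × X)) (complexSMulL z) := by
  ext p <;> (simp [complexSMulL]; module)

lemma complexFunctional_smul_pow (φ : X →L[ℝ] ℝ) (Q : X →L[ℝ] X) (w : ℂ) (k : ℕ) (p : X × X) :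
    complexFunctional φ (((complexSMulL w * Q.prodMap Q) ^ k : (X × X) →L[ℝ] (X × X)) p) =
      w ^ k * complexFunctional (φ ∘L Q ^ k) p := by
  induction k generalizing p with
  | zero => simp [complexFunctional_apply]
  | succ k ih =>
    rw [pow_succ, mul_apply_eq_comp, ih, (commute_complexSMulL Q w).eq,
      mul_apply_eq_comp, complexSMulL_apply]
    have : complexFunctional (φ ∘L Q ^ k) (Q.prodMap Q (complexSMul w p)) =
        complexFunctional (φ ∘L Q ^ (k + 1)) (complexSMul w p) := by
      simp [complexFunctional_apply, pow_succ]
    rw [this, complexFunctional_complexSMul]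
    ring

end Complexification

/-- The expansion `(1 - a)⁻² = ∑_{k ≤ n} (k + 1) a ^ k + remainder`. -/
lemma one_sub_sq_mul_sum {R : Type*} [Ring R] (a : R) (n : ℕ) :
    (1 - a) * (1 - a) * ∑ k ∈ Finset.range (n + 1), (k + 1) • a ^ k =
      1 - (n + 2) • a ^ (n + 1) + (n + 1) • a ^ (n + 2) := by
  induction n with
  | zero => simp; noncomm_ring
  | succ n ih =>
    have h : (1 - a) * (1 - a) * a ^ (n + 1) =
        a ^ (n + 1) - 2 • a ^ (n + 2) + a ^ (n + 3) := by
      rw [show n + 2 = 1 + (n + 1) by ring, show n + 3 = 1 + (1 + (n + 1)) by ring,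
        pow_add a 1 (1 + (n + 1)), pow_add a 1 (n + 1)]
      noncomm_ring
    rw [Finset.sum_range_succ, mul_add, ih, mul_smul_comm, h]
    module

section Ritt

variable {X : Type*} [NormedAddCommGroup X] [NormedSpace ℝ X]

/-- `P` is a two-sided inverse of `1 - w Q` on the complexification for each `w` in the unit disc,
with norm at most `C / ‖1 - w‖`. -/
structure IsRittResolvent (Q : X →L[ℝ] X) (C : ℝ) (P : ℂ → (X × X) →L[ℝ] (X × X)) : Prop where
  left_inv : ∀ w : ℂ, ‖w‖ < 1 → P w * oneSubSMul Q w = 1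
  right_inv : ∀ w : ℂ, ‖w‖ < 1 → oneSubSMul Q w * P w = 1
  norm_le : ∀ w : ℂ, ‖w‖ < 1 → ‖P w‖ ≤ C * ‖1 - w‖⁻¹

namespace IsRittResolvent

variable {Q : X →L[ℝ] X} {C : ℝ} {P : ℂ → (X × X) →L[ℝ] (X × X)} (hP : IsRittResolvent Q C P)
include hP

lemma commute {w : ℂ} (hw : ‖w‖ < 1) {a : (X × X) →L[ℝ] (X × X)}
    (ha : Commute a (oneSubSMul Q w)) : Commute a (P w) := by
  calc a * P w = (P w * oneSubSMul Q w) * (a * P w) := by rw [hP.left_inv w hw, one_mul]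
    _ = P w * (oneSubSMul Q w * a) * P w := by simp only [mul_assoc]
    _ = P w * (a * oneSubSMul Q w) * P w := by rw [ha.eq]
    _ = P w * a * (oneSubSMul Q w * P w) := by simp only [mul_assoc]
    _ = P w * a := by rw [hP.right_inv w hw, mul_one]

lemma continuousAt [CompleteSpace X] {w : ℂ} (hw : ‖w‖ < 1) : ContinuousAt P w := by
  have hinv : ∀ v : ℂ, ‖v‖ < 1 → P v = Ring.inverse (oneSubSMul Q v) := fun v hv =>
    (Ring.inverse_unit ⟨oneSubSMul Q v, P v, hP.right_inv v hv, hP.left_inv v hv⟩).symm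
  have hT : Continuous (oneSubSMul Q) :=
    continuous_const.sub (continuous_complexSMulL.mul continuous_const)
  have h1 : ContinuousAt (fun v => Ring.inverse (oneSubSMul Q v)) w :=
    ContinuousAt.comp (f := oneSubSMul Q) (x := w) (NormedRing.inverse_continuousAt
      ⟨oneSubSMul Q w, P w, hP.right_inv w hw, hP.left_inv w hw⟩) hT.continuousAt
  refine h1.congr ?_
  filter_upwards [(isOpen_lt continuous_norm continuous_const).mem_nhds hw] with v hv
  exact (hinv v hv).symm

lemma sub_eq {v w : ℂ} (hv : ‖v‖ < 1) (hw : ‖w‖ < 1) :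
    P v - P w = complexSMulL (v - w) * (P v * Q.prodMap Q * P w) := by
  have hc : Commute (complexSMulL (v - w)) (P v) := by
    refine hP.commute hv (Commute.sub_right (Commute.one_right _) ?_)
    exact (complexSMulL_mul_comm _ _).mul_right (commute_complexSMulL Q _)
  have hT : oneSubSMul Q w - oneSubSMul Q v = complexSMulL (v - w) * Q.prodMap Q := by
    ext p <;> (simp [oneSubSMul, complexSMulL]; module)
  calc P v - P w = P v * (oneSubSMul Q w * P w) - (P v * oneSubSMul Q v) * P w := by
        rw [hP.left_inv v hv, hP.right_inv w hw, mul_one, one_mul]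
    _ = P v * (oneSubSMul Q w - oneSubSMul Q v) * P w := by
      simp only [mul_sub, sub_mul, mul_assoc]
    _ = P v * complexSMulL (v - w) * Q.prodMap Q * P w := by rw [hT]; noncomm_ring
    _ = _ := by rw [← hc.eq]; noncomm_ring

lemma sq_sub_eq {v w : ℂ} (hv : ‖v‖ < 1) (hw : ‖w‖ < 1) :
    P v * P v - P w * P w = complexSMulL (v - w) *
      (P v * Q.prodMap Q * P w * P v + P w * (P v * Q.prodMap Q * P w)) := by
  have hc : Commute (complexSMulL (v - w)) (P w) := by
    refine hP.commute hw (Commute.sub_right (Commute.one_right _) ?_)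
    exact (complexSMulL_mul_comm _ _).mul_right (commute_complexSMulL Q _)
  calc P v * P v - P w * P w = (P v - P w) * P v + P w * (P v - P w) := by
        simp only [mul_sub, sub_mul]; abel
    _ = complexSMulL (v - w) * (P v * Q.prodMap Q * P w * P v) +
        P w * complexSMulL (v - w) * (P v * Q.prodMap Q * P w) := by
      rw [hP.sub_eq hv hw]; noncomm_ring
    _ = _ := by rw [← hc.eq]; noncomm_ring

/-- The scalar functions `w ↦ ⟨φ, (1 - w Q)⁻² q⟩` are holomorphic on the unit disc: by the resolvent
identity the difference quotient is a continuous function. -/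
lemma differentiableOn [CompleteSpace X] (φ : X →L[ℝ] ℝ) (q : X × X) :
    DifferentiableOn ℂ (fun w => complexFunctional φ ((P w * P w) q)) (Metric.ball 0 1) := by
  intro w hw
  have hw' : ‖w‖ < 1 := by simpa using hw
  let D : ℂ → (X × X) →L[ℝ] (X × X) := fun v =>
    P v * Q.prodMap Q * P w * P v + P w * (P v * Q.prodMap Q * P w)
  have hD : ContinuousAt (fun v => complexFunctional φ (D v q)) w := by
    have hc := hP.continuousAt hw'
    have h1 : ContinuousAt D w :=
      (((hc.mul continuousAt_const).mul continuousAt_const).mul hc).add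
        (continuousAt_const.mul ((hc.mul continuousAt_const).mul continuousAt_const))
    exact (complexFunctional φ).continuous.continuousAt.comp (h1.clm_apply continuousAt_const)
  have hder : HasDerivAt (fun w => complexFunctional φ ((P w * P w) q))
      (complexFunctional φ (D w q)) w := by
    rw [hasDerivAt_iff_tendsto_slope]
    refine (hD.tendsto.mono_left nhdsWithin_le_nhds).congr' ?_
    filter_upwards [self_mem_nhdsWithin, mem_nhdsWithin_of_mem_nhds
      ((isOpen_lt continuous_norm continuous_const).mem_nhds hw')] with v hne hv
    have hne' : v - w ≠ 0 := sub_ne_zero.2 hne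
    rw [slope_def_field, ← map_sub, ← sub_apply, hP.sq_sub_eq hv hw',
      mul_apply_eq_comp, complexSMulL_apply, complexFunctional_complexSMul, mul_div_cancel_left₀ _ hne']
  exact hder.differentiableAt.differentiableWithinAt

lemma expansion (φ : X →L[ℝ] ℝ) (x : X) (n : ℕ) {w : ℂ} (hw : ‖w‖ < 1) :
    complexFunctional φ ((P w * P w) (x, 0)) =
      ∑ k ∈ Finset.range (n + 1), (((k : ℝ) + 1) * φ ((Q ^ k) x) : ℝ) * w ^ k +
      w ^ (n + 1) * ((n + 2) * complexFunctional (φ ∘L Q ^ (n + 1)) ((P w * P w) (x, 0)) -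
        (n + 1) * (w * complexFunctional (φ ∘L Q ^ (n + 2)) ((P w * P w) (x, 0)))) := by
  set a : (X × X) →L[ℝ] (X × X) := complexSMulL w * Q.prodMap Q with ha
  have hT : oneSubSMul Q w = 1 - a := rfl
  have hca : Commute a (P w * P w) := by
    have : Commute a (P w) := hP.commute hw (by
      rw [hT]; exact (Commute.one_right a).sub_right (Commute.refl a))
    exact this.mul_right this
  have hid := congrArg (fun b => P w * P w * b) (one_sub_sq_mul_sum a n)
  have hPP : P w * P w * ((1 - a) * (1 - a)) = 1 := by
    rw [← hT]
    calc _ = P w * (P w * oneSubSMul Q w) * oneSubSMul Q w := by noncomm_ring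
      _ = 1 := by rw [hP.left_inv w hw, mul_one, hP.left_inv w hw]
  beta_reduce at hid
  rw [← mul_assoc, hPP, one_mul] at hid
  have hsum : P w * P w = (∑ k ∈ Finset.range (n + 1), (k + 1) • a ^ k) +
      ((n + 2) • (a ^ (n + 1) * (P w * P w)) - (n + 1) • (a ^ (n + 2) * (P w * P w))) := by
    rw [hid, (hca.pow_left _).eq, (hca.pow_left _).eq, mul_add, mul_sub, mul_smul_comm,
      mul_smul_comm, mul_one]
    abel
  have hφ0 : ∀ ψ : X →L[ℝ] ℝ, complexFunctional ψ (x, 0) = ψ x := by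
    intro ψ; simp [complexFunctional_apply]
  conv_lhs => rw [hsum]
  rw [add_apply, sub_apply, sum_apply, smul_apply, smul_apply, map_add, map_sub, map_sum, map_nsmul,
    map_nsmul, mul_apply_eq_comp (a ^ (n + 1)), mul_apply_eq_comp (a ^ (n + 2)),
    complexFunctional_smul_pow, complexFunctional_smul_pow]
  congr 1
  · refine Finset.sum_congr rfl fun k _ => ?_
    rw [smul_apply, map_nsmul, complexFunctional_smul_pow, hφ0, nsmul_eq_mul]
    push_cast
    rw [Function.comp_apply]
    ring
  · rw [nsmul_eq_mul, nsmul_eq_mul]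
    push_cast
    ring

/-- A Ritt type resolvent condition implies power boundedness. -/
lemma norm_pow_le [CompleteSpace X] (hC : 0 ≤ C) (n : ℕ) :
    ‖Q ^ n‖ ≤ 1 + 2 * Real.exp 1 * C ^ 2 := by
  have hK : 0 ≤ 2 * Real.exp 1 * C ^ 2 := by positivity
  rcases Nat.eq_zero_or_pos n with rfl | hn
  · rw [pow_zero]
    refine ContinuousLinearMap.norm_id_le.trans (by linarith)
  refine ContinuousLinearMap.opNorm_le_bound _ (by linarith) fun x => ?_
  refine NormedSpace.norm_le_dual_bound ℝ _ (by positivity) fun φ => ?_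
  have hg : DifferentiableOn ℂ (fun w : ℂ =>
      ((n : ℂ) + 2) * complexFunctional (φ ∘L Q ^ (n + 1)) ((P w * P w) (x, 0)) -
        (n + 1) * (w * complexFunctional (φ ∘L Q ^ (n + 2)) ((P w * P w) (x, 0))))
      (Metric.ball 0 1) :=
    ((hP.differentiableOn _ _).const_mul _).sub
      ((differentiableOn_id.mul (hP.differentiableOn _ _)).const_mul _)
  have hM : ∀ z : ℂ, ‖z‖ < 1 → ‖complexFunctional φ ((P z * P z) (x, 0))‖ ≤
      (2 * ‖φ‖ * C ^ 2 * ‖x‖) * (‖1 - z‖ ^ 2)⁻¹ := by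
    intro z hz
    have h1 := hP.norm_le z hz
    have h2 : ‖P z * P z‖ ≤ C ^ 2 * (‖1 - z‖ ^ 2)⁻¹ := by
      refine (norm_mul_le _ _).trans ?_
      calc ‖P z‖ * ‖P z‖ ≤ (C * ‖1 - z‖⁻¹) * (C * ‖1 - z‖⁻¹) := by gcongr
        _ = _ := by rw [← inv_pow]; ring
    have h3 : ‖((x, 0) : X × X)‖ = ‖x‖ := by simp [Prod.norm_def]
    refine (norm_complexFunctional_le _ _).trans ?_
    calc 2 * ‖φ‖ * ‖(P z * P z) (x, 0)‖ ≤ 2 * ‖φ‖ * (C ^ 2 * (‖1 - z‖ ^ 2)⁻¹ * ‖x‖) := by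
          gcongr
          refine ((P z * P z).le_opNorm _).trans ?_
          rw [h3]
          gcongr
      _ = _ := by ring
  have key := norm_coeff_le (c := fun k => (((k : ℝ) + 1) * φ ((Q ^ k) x) : ℝ)) hn hg
    (fun z hz => hP.expansion φ x n hz) hM
  rw [Complex.norm_real, norm_mul, Real.norm_of_nonneg (by positivity : (0 : ℝ) ≤ n + 1)] at key
  have h4 : ‖φ ((Q ^ n) x)‖ ≤ Real.exp 1 * (2 * ‖φ‖ * C ^ 2 * ‖x‖) := by
    refine le_of_mul_le_mul_left (key.trans_eq ?_) (by positivity : (0 : ℝ) < n + 1)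
    ring
  refine h4.trans ?_
  have : 0 ≤ ‖x‖ * ‖φ‖ := by positivity
  nlinarith

end IsRittResolvent

end Ritt

/-! ### Resolvents of sectorial operators of angle less than `π / 2` -/

section Resolvent

variable {X : Type*} [NormedAddCommGroup X] [NormedSpace ℝ X]

/-- Half-plane form of sectoriality of angle less than `π / 2`. -/
lemma exists_halfPlane_bound {A : X →ₗ.[ℝ] X} (hA : IsSectorial A)
    (hangle : sectorialityAngle A < Real.pi / 2) :
    A.IsClosed ∧ Dense (A.domain : Set X) ∧
    ∃ M : ℝ, 0 ≤ M ∧ ∀ z : ℂ, z.re < 0 → Function.Bijective (complexShift A z) ∧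
      ∀ p : A.domain × A.domain, ‖z‖ * ‖((p.1 : X), (p.2 : X))‖ ≤ M * ‖complexShift A z p‖ := by
  obtain ⟨σ, hσ, hlt⟩ := exists_lt_of_csInf_lt (show {σ : ℝ | IsSectorialOfType A σ}.Nonempty from hA)
    hangle
  refine ⟨hσ.closed, hσ.dense_domain, ?_⟩
  obtain ⟨M, hM⟩ := hσ.bound (Real.pi / 2) hlt (by linarith [Real.pi_pos])
  refine ⟨max M 0, le_max_right _ _, fun z hz => ⟨?_, fun p => ?_⟩⟩
  · have hcl : closure (sector σ) ⊆ {w : ℂ | 0 ≤ w.re} := by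
      refine closure_minimal (fun w hw => ?_) (isClosed_le continuous_const Complex.continuous_re)
      exact Complex.abs_arg_le_pi_div_two_iff.1 (hw.2.le.trans hlt.le)
    by_contra hcon
    have : z ∈ operatorSpectrum A := fun h => hcon h.1
    exact absurd (hcl (hσ.spectrum_subset this)) (not_le.2 hz)
  · have hz0 : z ≠ 0 := by rintro rfl; simp at hz
    have harg : Real.pi / 2 < |z.arg| := by
      by_contra hcon
      exact absurd (Complex.abs_arg_le_pi_div_two_iff.1 (not_lt.1 hcon)) (not_le.2 hz)
    exact (hM z hz0 harg p).trans (by gcongr; exact le_max_left _ _)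

/-- `R = (l + A)⁻¹`, expressed through the graph of `A`. -/
structure IsResolvent (A : X →ₗ.[ℝ] X) (l : ℝ) (R : X →L[ℝ] X) : Prop where
  mem_graph : ∀ x : X, (R x, x - l • R x) ∈ A.graph
  apply_eq : ∀ x y : X, (x, y) ∈ A.graph → R (l • x + y) = x

lemma exists_isResolvent {A : X →ₗ.[ℝ] X} {M : ℝ} {l : ℝ} (hl : 0 < l)
    (h : Function.Bijective (complexShift A (-l : ℂ)))
    (hM : ∀ p : A.domain × A.domain,
      ‖(-l : ℂ)‖ * ‖((p.1 : X), (p.2 : X))‖ ≤ M * ‖complexShift A (-l : ℂ) p‖) :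
    ∃ R : X →L[ℝ] X, IsResolvent A l R := by
  let T : A.domain →ₗ[ℝ] X := l • A.domain.subtype + A.toFun
  have hT : ∀ a : A.domain, T a = l • (a : X) + A a := fun a => rfl
  have hsh : ∀ p : A.domain × A.domain, complexShift A (-l : ℂ) p = (-(T p.1), -(T p.2)) := by
    intro p
    simp only [complexShift, complexSMul, hT]
    ext <;> simp <;> abel
  have hbij : Function.Bijective T := by
    constructor
    · intro a b hab
      have : (a, (0 : A.domain)) = (b, 0) := h.1 (by rw [hsh, hsh]; simp [hab])
      exact (Prod.ext_iff.1 this).1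
    · intro x
      obtain ⟨p, hp⟩ := h.2 (-x, 0)
      rw [hsh] at hp
      exact ⟨p.1, neg_injective (Prod.ext_iff.1 hp).1⟩
  let e := LinearEquiv.ofBijective T hbij
  have he : ∀ x, T (e.symm x) = x := fun x => e.apply_symm_apply x
  let R : X →L[ℝ] X := (A.domain.subtype ∘ₗ e.symm.toLinearMap).mkContinuous (l⁻¹ * M) (by
    intro x
    have := hM (e.symm x, 0)
    rw [hsh] at this
    simp only [he, map_zero, neg_zero, ZeroMemClass.coe_zero, Prod.norm_mk, norm_zero, norm_neg,
      norm_nonneg, max_eq_left, Complex.norm_real, Real.norm_of_nonneg hl.le] at this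
    rw [mul_assoc, inv_mul_eq_div, le_div_iff₀ hl, mul_comm]
    exact this)
  have hR : ∀ x, R x = (e.symm x : A.domain) := fun x => rfl
  refine ⟨R, fun x => ?_, fun x y hxy => ?_⟩
  · rw [LinearPMap.mem_graph_iff]
    refine ⟨e.symm x, (hR x).symm, ?_⟩
    have := he x
    rw [hT] at this
    rw [hR, eq_sub_iff_add_eq, add_comm]
    exact this
  · rw [LinearPMap.mem_graph_iff] at hxy
    obtain ⟨a, rfl, rfl⟩ := hxy
    rw [hR]
    congr 1
    exact e.symm_apply_apply a

namespace IsResolvent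

variable {A : X →ₗ.[ℝ] X} {l : ℝ} {R : X →L[ℝ] X}

/-- Two resolvents commute. -/
lemma commute {m : ℝ} {R' : X →L[ℝ] X} (hR : IsResolvent A l R) (hR' : IsResolvent A m R') :
    Commute R R' := by
  have key : ∀ {a b : ℝ} {S S' : X →L[ℝ] X}, IsResolvent A a S → IsResolvent A b S' →
      ∀ x, S' x = S x + (a - b) • S (S' x) := by
    intro a b S S' hS hS' x
    have := hS.apply_eq _ _ (hS'.mem_graph x)
    calc S' x = S (a • S' x + (x - b • S' x)) := this.symm
      _ = S (x + (a - b) • S' x) := by congr 1; module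
      _ = _ := by rw [map_add, map_smul]
  by_cases hlm : l = m
  · subst hlm
    have : R = R' := by
      ext x
      have := key hR hR' x
      simp at this
      exact this.symm
    rw [this]
  · ext x
    have h1 := key hR hR' x
    have h2 := key hR' hR x
    have h3 : (l - m) • (R (R' x) - R' (R x)) = 0 := by
      have e1 : (l - m) • R (R' x) = R' x - R x := by rw [eq_sub_iff_add_eq, add_comm]; exact h1.symm
      have e2 : (m - l) • R' (R x) = R x - R' x := by rw [eq_sub_iff_add_eq, add_comm]; exact h2.symm
      have e3 : (l - m) • R' (R x) = R' x - R x := by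
        rw [← neg_sub m l, neg_smul, e2, neg_sub]
      rw [smul_sub, e1, e3, sub_self]
    have h4 := (smul_eq_zero.1 h3).resolve_left (sub_ne_zero.2 hlm)
    exact sub_eq_zero.1 h4

/-- The resolvent condition of Ritt type for `l (l + A)⁻¹`: formally
`(1 - w l (l + A)⁻¹)⁻¹ = 1 + w l (l (1 - w) + A)⁻¹`, and `l (1 - w)` lies in the right half-plane if
`‖w‖ < 1`. -/
lemma exists_isRittResolvent (hR : IsResolvent A l R) (hl : 0 < l) {M : ℝ} (hM0 : 0 ≤ M)
    (hM : ∀ z : ℂ, z.re < 0 → Function.Bijective (complexShift A z) ∧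
      ∀ p : A.domain × A.domain, ‖z‖ * ‖((p.1 : X), (p.2 : X))‖ ≤ M * ‖complexShift A z p‖) :
    ∃ P, IsRittResolvent (l • R) (2 + 2 * M) P := by
  have key : ∀ w : ℂ, ‖w‖ < 1 → ∃ P : (X × X) →L[ℝ] (X × X), P * oneSubSMul (l • R) w = 1 ∧
      oneSubSMul (l • R) w * P = 1 ∧ ‖P‖ ≤ (2 + 2 * M) * ‖1 - w‖⁻¹ := by
    intro w hw
    set T := oneSubSMul (l • R) w with hTdef
    let z : ℂ := -(l : ℂ) * (1 - w)
    have hz : z.re < 0 := by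
      have : w.re < 1 := (Complex.re_le_norm w).trans_lt hw
      simp only [z, neg_mul, Complex.neg_re, Complex.re_ofReal_mul, Complex.sub_re, Complex.one_re]
      nlinarith
    obtain ⟨hbij, hbd⟩ := hM z hz
    let d : X → A.domain := fun x => ⟨R x, LinearPMap.mem_domain_of_mem_graph (hR.mem_graph x)⟩
    have hd : ∀ x, A (d x) = x - l • R x := fun x =>
      ((LinearPMap.mem_graph_iff _).1 (hR.mem_graph x)).elim fun a ha => by
        have : a = d x := Subtype.ext ha.1
        rw [← this]; exact ha.2
    let D : X × X → A.domain × A.domain := fun q => (d q.1, d q.2)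
    have hTq : ∀ q, T q = -complexShift A z (D q) := by
      intro q
      simp only [T, oneSubSMul, complexShift, complexSMul, D, hd, z, complexSMulL]
      ext <;> (simp [d]; module)
    have hdb : Function.Bijective d := by
      constructor
      · intro x y hxy
        have h1 := hd x
        have h2 : R x = R y := congrArg Subtype.val hxy
        rw [hxy, hd y, h2] at h1
        simpa using h1.symm
      · intro a
        refine ⟨l • (a : X) + A a, Subtype.ext ?_⟩
        exact hR.apply_eq _ _ (A.mem_graph a)
    have hDb : Function.Bijective D := hdb.prodMap hdb
    have hTb : Function.Bijective T := by
      have : (T : X × X → X × X) = (fun p => -p) ∘ complexShift A z ∘ D := funext hTq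
      rw [this]
      exact (Equiv.neg _).bijective.comp (hbij.comp hDb)
    have hpos : 0 < ‖1 - w‖ := norm_pos_iff.2 (one_sub_ne_zero_of_norm_lt_one hw)
    have hTbd : ∀ q, ‖q‖ ≤ (2 + 2 * M) * ‖1 - w‖⁻¹ * ‖T q‖ := by
      intro q
      have h1 := hbd (D q)
      have h2 : ‖complexShift A z (D q)‖ = ‖T q‖ := by rw [hTq, norm_neg]
      have hzn : ‖z‖ = l * ‖1 - w‖ := by simp [z, abs_of_pos hl]
      rw [h2, hzn] at h1
      set p : X × X := (((D q).1 : X), ((D q).2 : X)) with hp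
      have h3 : q = T q + complexSMul w (l • p) := by
        simp only [T, oneSubSMul, complexSMul, hp, D, d, complexSMulL]
        ext <;> simp
      have h4 : ‖q‖ ≤ ‖T q‖ + 2 * ‖w‖ * (l * ‖p‖) := by
        conv_lhs => rw [h3]
        refine (norm_add_le _ _).trans ?_
        have := norm_complexSMul_le w (l • p)
        rw [norm_smul, Real.norm_of_nonneg hl.le] at this
        linarith
      have h5 : l * ‖p‖ ≤ M * ‖1 - w‖⁻¹ * ‖T q‖ := by
        have : l * ‖p‖ = ‖1 - w‖⁻¹ * (l * ‖1 - w‖ * ‖p‖) := by field_simp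
        rw [this]
        calc _ ≤ ‖1 - w‖⁻¹ * (M * ‖T q‖) := by gcongr
          _ = _ := by ring
      have h6 : 1 ≤ 2 * ‖1 - w‖⁻¹ := by
        rw [← div_eq_mul_inv, le_div_iff₀ hpos]
        have := norm_sub_le (1 : ℂ) w
        rw [norm_one] at this
        linarith
      have h7 : 0 ≤ l * ‖p‖ := by positivity
      have h8 := mul_le_mul_of_nonneg_right h6 (norm_nonneg (T q))
      have h9 : ‖w‖ * (l * ‖p‖) ≤ l * ‖p‖ := mul_le_of_le_one_left h7 hw.le
      nlinarith
    let e := LinearEquiv.ofBijective (T : (X × X) →ₗ[ℝ] (X × X)) hTb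
    have he : ∀ q, T (e.symm q) = q := fun q => e.apply_symm_apply q
    have he' : ∀ q, e.symm (T q) = q := fun q => e.symm_apply_apply q
    have hb : ∀ q, ‖e.symm.toLinearMap q‖ ≤ (2 + 2 * M) * ‖1 - w‖⁻¹ * ‖q‖ := fun q => by
      have := hTbd (e.symm q)
      rwa [he] at this
    refine ⟨e.symm.toLinearMap.mkContinuous _ hb, ?_, ?_,
      LinearMap.mkContinuous_norm_le _ (by positivity) hb⟩
    · exact ContinuousLinearMap.ext fun q => he' q
    · exact ContinuousLinearMap.ext fun q => he q
  choose! P h1 h2 h3 using key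
  exact ⟨P, h1, h2, h3⟩

end IsResolvent

/-- Sectoriality of angle less than `π / 2` yields the hypothesis of the Hille–Yosida theorem. -/
theorem exists_powerBounded_resolvents [CompleteSpace X] {A : X →ₗ.[ℝ] X} (hA : IsSectorial A)
    (hangle : sectorialityAngle A < Real.pi / 2) :
    ∃ K : ℝ, ∀ l : ℝ, 0 < l →
      ∃ R : X →L[ℝ] X, IsResolvent A l R ∧ ∀ n : ℕ, ‖(l • R) ^ n‖ ≤ K := by
  obtain ⟨-, -, M, hM0, hM⟩ := exists_halfPlane_bound hA hangle
  refine ⟨1 + 2 * Real.exp 1 * (2 + 2 * M) ^ 2, fun l hl => ?_⟩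
  obtain ⟨h1, h2⟩ := hM (-l : ℂ) (by simpa using hl)
  obtain ⟨R, hR⟩ := exists_isResolvent hl h1 h2
  obtain ⟨P, hP⟩ := hR.exists_isRittResolvent hl hM0 hM
  exact ⟨R, hR, hP.norm_pow_le (by positivity)⟩

end Resolvent

/-! ### Generation of the semigroup -/

section Generation

variable {X : Type*} [NormedAddCommGroup X] [NormedSpace ℝ X] [CompleteSpace X]

lemma exp_add_smul (B : X →L[ℝ] X) (s t : ℝ) :
    NormedSpace.exp ((s + t) • B) = NormedSpace.exp (s • B) * NormedSpace.exp (t • B) := by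
  let _ : NormedAlgebra ℚ (X →L[ℝ] X) := NormedAlgebra.restrictScalars ℚ ℝ _
  rw [add_smul]
  exact NormedSpace.exp_add_of_commute (((Commute.refl B).smul_left s).smul_right t)

lemma continuous_exp_smul (B : X →L[ℝ] X) : Continuous fun t : ℝ => NormedSpace.exp (t • B) :=
  continuous_iff_continuousAt.2 fun t => (hasDerivAt_exp_smul_const (𝕂 := ℝ) B t).continuousAt

omit [CompleteSpace X] in
lemma commute_exp_smul {B B' : X →L[ℝ] X} (h : Commute B B') (s : ℝ) :
    Commute (NormedSpace.exp (s • B)) B' :=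
  (h.smul_left s).exp_left

/-- Power bounded operators `Q` give bounded semigroups `exp (t l (Q - 1))`. -/
lemma norm_exp_smul_sub_one_le {Q : X →L[ℝ] X} {K : ℝ} (hQ : ∀ n : ℕ, ‖Q ^ n‖ ≤ K) {l t : ℝ}
    (hl : 0 ≤ l) (ht : 0 ≤ t) : ‖NormedSpace.exp (t • (l • (Q - 1)))‖ ≤ K := by
  let _ : NormedAlgebra ℚ (X →L[ℝ] X) := NormedAlgebra.restrictScalars ℚ ℝ _
  set s := t * l with hs
  have hs0 : 0 ≤ s := mul_nonneg ht hl
  have h1 : t • (l • (Q - 1)) = s • Q + (-s) • (1 : X →L[ℝ] X) := by rw [hs]; module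
  have h2 : NormedSpace.exp ((-s) • (1 : X →L[ℝ] X)) = Real.exp (-s) • (1 : X →L[ℝ] X) := by
    have := (NormedSpace.algebraMap_exp_comm (𝕂 := ℝ) (𝔸 := X →L[ℝ] X) (-s))
    rw [Algebra.algebraMap_eq_smul_one, Algebra.algebraMap_eq_smul_one] at this
    rw [← this, Real.exp_eq_exp_ℝ]
  have h3 : ‖NormedSpace.exp (s • Q)‖ ≤ Real.exp s * K := by
    have hsum := NormedSpace.exp_series_hasSum_exp' (𝕂 := ℝ) (s • Q)
    have hsr := (NormedSpace.exp_series_hasSum_exp' (𝕂 := ℝ) s).mul_right K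
    rw [← Real.exp_eq_exp_ℝ] at hsr
    refine hsum.norm_le_of_bounded hsr fun k => ?_
    rw [smul_pow, norm_smul, norm_smul, norm_inv, Real.norm_of_nonneg (by positivity : (0:ℝ) ≤ _),
      Real.norm_of_nonneg (pow_nonneg hs0 k), smul_eq_mul, mul_assoc]
    gcongr
    exact hQ k
  rw [h1, NormedSpace.exp_add_of_commute ((Commute.one_right _).smul_right _), h2, mul_smul_comm,
    mul_one, norm_smul, Real.norm_of_nonneg (Real.exp_pos _).le, Real.exp_neg,
    inv_mul_le_iff₀ (Real.exp_pos _)]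
  exact h3

/-- Two bounded semigroups with commuting generators are close on a vector on which the generators
are close. -/
lemma norm_exp_sub_exp_apply_le {B B' : X →L[ℝ] X} (hc : Commute B B') {K : ℝ}
    (hB : ∀ t : ℝ, 0 ≤ t → ‖NormedSpace.exp (t • B)‖ ≤ K)
    (hB' : ∀ t : ℝ, 0 ≤ t → ‖NormedSpace.exp (t • B')‖ ≤ K) {t : ℝ} (ht : 0 ≤ t) (x : X) :
    ‖NormedSpace.exp (t • B) x - NormedSpace.exp (t • B') x‖ ≤ K * K * ‖B x - B' x‖ * t := by
  let f : ℝ → X := fun s => (NormedSpace.exp ((t - s) • B') * NormedSpace.exp (s • B)) x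
  have hder : ∀ s, HasDerivAt f
      ((NormedSpace.exp ((t - s) • B') * NormedSpace.exp (s • B)) (B x - B' x)) s := by
    intro s
    have h1 := hasDerivAt_exp_smul_const (𝕂 := ℝ) B s
    have h2 : HasDerivAt (fun u : ℝ => NormedSpace.exp ((t - u) • B'))
        ((-1 : ℝ) • (NormedSpace.exp ((t - s) • B') * B')) s :=
      (hasDerivAt_exp_smul_const (𝕂 := ℝ) B' (t - s)).scomp s ((hasDerivAt_id s).const_sub t)
    have h3 := (h2.mul h1).clm_apply (hasDerivAt_const s x)
    refine h3.congr_deriv ?_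
    have h4 := commute_exp_smul hc s
    have h5 : (-1 : ℝ) • (NormedSpace.exp ((t - s) • B') * B') * NormedSpace.exp (s • B) +
        NormedSpace.exp ((t - s) • B') * (NormedSpace.exp (s • B) * B) =
        NormedSpace.exp ((t - s) • B') * NormedSpace.exp (s • B) * (B - B') := by
      rw [neg_one_smul, neg_mul, mul_assoc, ← h4.eq, mul_sub, mul_assoc, mul_assoc]
      abel
    rw [h5, map_zero, add_zero, mul_apply_eq_comp, sub_apply]
  have hK : 0 ≤ K := (norm_nonneg _).trans (hB 0 le_rfl)
  have := norm_image_sub_le_of_norm_deriv_right_le_segment (f := f) (a := 0) (b := t)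
    (fun s _ => (hder s).continuousAt.continuousWithinAt)
    (fun s _ => (hder s).hasDerivWithinAt) (C := K * K * ‖B x - B' x‖) (fun s hs => by
      refine (ContinuousLinearMap.le_opNorm _ _).trans ?_
      gcongr
      refine (norm_mul_le _ _).trans ?_
      gcongr
      · exact hB' _ (by linarith [hs.2])
      · exact hB _ hs.1) t ⟨ht, le_rfl⟩
  simpa [f] using this

/-- The resolvents `(n + 1 + A)⁻¹` of an operator satisfying the hypothesis of the Hille–Yosida
theorem. -/
structure IsResolventSeq (A : X →ₗ.[ℝ] X) (K : ℝ) (R : ℕ → X →L[ℝ] X) : Prop where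
  isResolvent : ∀ n : ℕ, IsResolvent A (n + 1) (R n)
  norm_pow_le : ∀ n k : ℕ, ‖(((n : ℝ) + 1) • R n) ^ k‖ ≤ K
  dense : Dense (A.domain : Set X)

/-- The Yosida approximations of `-A`. -/
def yosida (R : ℕ → X →L[ℝ] X) (n : ℕ) : X →L[ℝ] X :=
  ((n : ℝ) + 1) • (((n : ℝ) + 1) • R n - 1)

namespace IsResolventSeq

variable {A : X →ₗ.[ℝ] X} {K : ℝ} {R : ℕ → X →L[ℝ] X} (hR : IsResolventSeq A K R)
include hR

omit [CompleteSpace X] in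
lemma nonneg : 0 ≤ K := (norm_nonneg _).trans (hR.norm_pow_le 0 0)

omit [CompleteSpace X] in
lemma norm_smul_le (n : ℕ) : ‖((n : ℝ) + 1) • R n‖ ≤ K := by
  simpa using hR.norm_pow_le n 1

lemma norm_exp_le (n : ℕ) {t : ℝ} (ht : 0 ≤ t) : ‖NormedSpace.exp (t • yosida R n)‖ ≤ K :=
  norm_exp_smul_sub_one_le (hR.norm_pow_le n) (by positivity) ht

omit [CompleteSpace X] in
lemma commute_yosida (n m : ℕ) : Commute (yosida R n) (yosida R m) := by
  have h := (hR.isResolvent n).commute (hR.isResolvent m)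
  have h1 : Commute (((n : ℝ) + 1) • R n - 1) (((m : ℝ) + 1) • R m - 1) :=
    (((h.smul_left _).smul_right _).sub_left (Commute.one_left _)).sub_right (Commute.one_right _)
  exact (h1.smul_left _).smul_right _

omit [CompleteSpace X] in
lemma yosida_apply (n : ℕ) {x y : X} (hxy : (x, y) ∈ A.graph) :
    yosida R n x = -((((n : ℝ) + 1) • R n) y) := by
  have h := (hR.isResolvent n).apply_eq x y hxy
  rw [map_add, map_smul] at h
  have h2 : ((n : ℝ) + 1) • R n x - x = - R n y := by
    nth_rewrite 2 [← h]; abel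
  simp only [yosida, smul_apply, sub_apply, one_apply_eq_self, h2, smul_neg]

omit [CompleteSpace X] in
lemma tendsto_smul_resolvent (y : X) :
    Tendsto (fun n : ℕ => (((n : ℝ) + 1) • R n) y) atTop (𝓝 y) := by
  have hK := hR.nonneg
  have hinv : Tendsto (fun n : ℕ => ((n : ℝ) + 1)⁻¹) atTop (𝓝 0) :=
    tendsto_inv_atTop_zero.comp (tendsto_natCast_atTop_atTop.atTop_add tendsto_const_nhds)
  have hdom : ∀ x z : X, (x, z) ∈ A.graph →
      Tendsto (fun n : ℕ => (((n : ℝ) + 1) • R n) x) atTop (𝓝 x) := by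
    intro x z hxz
    rw [tendsto_iff_norm_sub_tendsto_zero]
    refine squeeze_zero (g := fun n : ℕ => ((n : ℝ) + 1)⁻¹ * (K * ‖z‖)) (fun _ => norm_nonneg _)
      (fun n => ?_) (by simpa using hinv.mul_const (K * ‖z‖))
    have h := (hR.isResolvent n).apply_eq x z hxz
    rw [map_add, map_smul] at h
    have h2 : (((n : ℝ) + 1) • R n) x - x = - (((n : ℝ) + 1)⁻¹ • (((n : ℝ) + 1) • R n) z) := by
      have hn : ((n : ℝ) + 1) ≠ 0 := by positivity
      nth_rewrite 2 [← h]
      rw [smul_apply, smul_apply, inv_smul_smul₀ hn]; abel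
    rw [h2, norm_neg, norm_smul, Real.norm_of_nonneg (by positivity)]
    gcongr
    exact (ContinuousLinearMap.le_opNorm _ _).trans (by gcongr; exact hR.norm_smul_le n)
  rw [Metric.tendsto_atTop]
  intro ε hε
  obtain ⟨x, hx, hxy⟩ := Metric.mem_closure_iff.1 (hR.dense y) (ε / (2 * (K + 1))) (by positivity)
  obtain ⟨N, hN⟩ := Metric.tendsto_atTop.1 (hdom x (A ⟨x, hx⟩) (A.mem_graph ⟨x, hx⟩)) (ε / 2)
    (by positivity)
  refine ⟨N, fun n hn => ?_⟩
  have h1 := hN n hn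
  have h2 : dist ((((n : ℝ) + 1) • R n) y) ((((n : ℝ) + 1) • R n) x) ≤ K * dist y x := by
    rw [dist_eq_norm, dist_eq_norm, ← map_sub]
    exact (ContinuousLinearMap.le_opNorm _ _).trans (by gcongr; exact hR.norm_smul_le n)
  have h3 : (K + 1) * dist y x < ε / 2 := by
    rw [lt_div_iff₀ (by positivity)] at hxy
    linarith
  have h4 := dist_triangle4 ((((n : ℝ) + 1) • R n) y) ((((n : ℝ) + 1) • R n) x) x y
  rw [dist_comm x y] at h4
  linarith

omit [CompleteSpace X] in
lemma tendsto_yosida {x y : X} (hxy : (x, y) ∈ A.graph) :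
    Tendsto (fun n => yosida R n x) atTop (𝓝 (-y)) := by
  simp only [fun n => hR.yosida_apply n hxy]
  exact (hR.tendsto_smul_resolvent y).neg

lemma uniformCauchySeqOn (x : X) {a : ℝ} (ha : 0 ≤ a) :
    UniformCauchySeqOn (fun (n : ℕ) (t : ℝ) => NormedSpace.exp (t • yosida R n) x) atTop
      (Set.Icc 0 a) := by
  have hK := hR.nonneg
  rw [Metric.uniformCauchySeqOn_iff]
  intro ε hε
  obtain ⟨z, hz, hxz⟩ := Metric.mem_closure_iff.1 (hR.dense x) (ε / (4 * (K + 1))) (by positivity)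
  have hc := (hR.tendsto_yosida (A.mem_graph ⟨z, hz⟩)).cauchySeq
  obtain ⟨N, hN⟩ := Metric.cauchySeq_iff.1 hc (ε / (2 * (K * K * a + 1))) (by positivity)
  refine ⟨N, fun m hm n hn t ht => ?_⟩
  have h1 := norm_exp_sub_exp_apply_le (hR.commute_yosida m n) (fun _ h => hR.norm_exp_le m h)
    (fun _ h => hR.norm_exp_le n h) ht.1 z
  have h2 := hN m hm n hn
  rw [dist_eq_norm] at h2
  have h3 : ∀ k, dist (NormedSpace.exp (t • yosida R k) x) (NormedSpace.exp (t • yosida R k) z) ≤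
      K * dist x z := by
    intro k
    rw [dist_eq_norm, dist_eq_norm, ← map_sub]
    exact (ContinuousLinearMap.le_opNorm _ _).trans (by gcongr; exact hR.norm_exp_le k ht.1)
  have h4 : (K + 1) * dist x z < ε / 4 := by
    rw [lt_div_iff₀ (by positivity)] at hxz
    linarith
  have h5 : K * K * ‖yosida R m z - yosida R n z‖ * t < ε / 2 := by
    rw [lt_div_iff₀ (by positivity)] at h2
    have : K * K * ‖yosida R m z - yosida R n z‖ * t ≤ K * K * ‖yosida R m z - yosida R n z‖ * a := by
      gcongr; exact ht.2
    have h0 := norm_nonneg (yosida R m z - yosida R n z)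
    by_cases hz0 : ‖yosida R m z - yosida R n z‖ = 0
    · rw [hz0]; simp; exact hε
    · have : 0 < ‖yosida R m z - yosida R n z‖ := lt_of_le_of_ne h0 (Ne.symm hz0)
      nlinarith
  have h6 := dist_triangle4 (NormedSpace.exp (t • yosida R m) x)
    (NormedSpace.exp (t • yosida R m) z) (NormedSpace.exp (t • yosida R n) z)
    (NormedSpace.exp (t • yosida R n) x)
  have h7 := h3 m
  have h8 := h3 n
  rw [dist_comm] at h8
  rw [dist_eq_norm (NormedSpace.exp (t • yosida R m) z)] at h6
  have := dist_nonneg (x := x) (y := z)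
  linarith

lemma exists_limit (t : ℝ) : ∃ S : X →L[ℝ] X, ∀ x,
    Tendsto (fun n : ℕ => NormedSpace.exp (max t 0 • yosida R n) x) atTop (𝓝 (S x)) := by
  have h : ∀ x, ∃ y, Tendsto (fun n : ℕ => NormedSpace.exp (max t 0 • yosida R n) x) atTop (𝓝 y) := by
    intro x
    exact cauchySeq_tendsto_of_complete
      ((hR.uniformCauchySeqOn x (le_max_right t 0)).cauchySeq ⟨le_max_right t 0, le_rfl⟩)
  choose f hf using h
  exact ⟨continuousLinearMapOfTendsto (fun n : ℕ => NormedSpace.exp (max t 0 • yosida R n))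
    (tendsto_pi_nhds.2 hf), hf⟩

end IsResolventSeq

omit [CompleteSpace X] in
/-- A strongly continuous function with values in a bounded set of operators is jointly
continuous. -/
lemma continuous_uncurry_of_norm_le {S : ℝ → X →L[ℝ] X} {K : ℝ} (hK : ∀ t, ‖S t‖ ≤ K)
    (hS : ∀ x, Continuous fun t => S t x) : Continuous fun p : ℝ × X => S p.1 p.2 := by
  rw [continuous_iff_continuousAt]
  rintro ⟨t, x⟩
  have h1 : Tendsto (fun p : ℝ × X => S p.1 (p.2 - x)) (𝓝 (t, x)) (𝓝 0) := by
    refine squeeze_zero_norm (a := fun p : ℝ × X => K * ‖p.2 - x‖) (fun p => ?_) ?_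
    · exact (ContinuousLinearMap.le_opNorm _ _).trans (by gcongr; exact hK _)
    · have : Continuous fun p : ℝ × X => K * ‖p.2 - x‖ := by fun_prop
      simpa using this.tendsto (t, x)
  have h2 : Tendsto (fun p : ℝ × X => S p.1 x) (𝓝 (t, x)) (𝓝 (S t x)) :=
    ((hS x).comp continuous_fst).tendsto (t, x)
  have h3 := h1.add h2
  rw [zero_add] at h3
  exact h3.congr fun p => by rw [map_sub]; abel

omit [CompleteSpace X] in
/-- If `S(h) d - d = h d + o(h)` as `h ↓ 0` for a bounded semigroup `S`, then `d = 0`, as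
`S(t) d = exp(t) d` is bounded. -/
lemma eq_zero_of_semigroup_eigenvector {S : ℝ → X →L[ℝ] X} {K : ℝ} (hK : ∀ t, ‖S t‖ ≤ K)
    (h0 : S 0 = ContinuousLinearMap.id ℝ X)
    (hadd : ∀ s t : ℝ, 0 ≤ s → 0 ≤ t → S (s + t) = S s ∘L S t)
    (hcont : ∀ x, Continuous fun t => S t x) {d : X}
    (hd : Tendsto (fun t : ℝ => t⁻¹ • (S t d - d)) (𝓝[>] 0) (𝓝 d)) : d = 0 := by
  have hder : ∀ t : ℝ, 0 ≤ t → HasDerivWithinAt (fun t => S t d) (S t d) (Set.Ici t) t := by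
    intro t ht
    rw [hasDerivWithinAt_iff_tendsto_slope, Set.Ici_sdiff_left]
    have h1 : Tendsto (fun r : ℝ => S t ((r - t)⁻¹ • (S (r - t) d - d))) (𝓝[>] t) (𝓝 (S t d)) := by
      refine ((S t).continuous.tendsto d).comp (hd.comp ?_)
      refine tendsto_nhdsWithin_iff.2 ⟨?_, ?_⟩
      · have : Continuous fun r : ℝ => r - t := by fun_prop
        simpa using (this.tendsto t).mono_left nhdsWithin_le_nhds
      · filter_upwards [self_mem_nhdsWithin] with r hr using sub_pos.2 (show t < r from hr)
    refine h1.congr' ?_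
    filter_upwards [self_mem_nhdsWithin] with r hr
    have hr' : t < r := hr
    have : S r d = S t (S (r - t) d) := by
      have := hadd t (r - t) ht (sub_nonneg.2 hr'.le)
      rw [add_sub_cancel] at this
      rw [this]; rfl
    rw [slope_def_module, this, map_smul, map_sub]
  have hexp : ∀ t : ℝ, 0 ≤ t → Real.exp (-t) • S t d = d := by
    intro t ht
    have := constant_of_has_deriv_right_zero (f := fun t => Real.exp (-t) • S t d) (a := 0) (b := t)
      ((Continuous.smul (by fun_prop) (hcont d)).continuousOn) (fun s hs => by
        have h1 : HasDerivAt (fun t : ℝ => Real.exp (-t)) (Real.exp (-s) * -1) s :=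
          (hasDerivAt_neg s).exp
        refine (h1.hasDerivWithinAt.smul (hder s hs.1)).congr_deriv ?_
        module) t ⟨ht, le_rfl⟩
    simpa [h0] using this
  have hb : ∀ t : ℝ, 0 ≤ t → ‖d‖ ≤ Real.exp (-t) * (K * ‖d‖) := by
    intro t ht
    have h1 : ‖d‖ = Real.exp (-t) * ‖S t d‖ := by
      conv_lhs => rw [← hexp t ht, norm_smul, Real.norm_of_nonneg (Real.exp_pos _).le]
    rw [h1, mul_le_mul_iff_right₀ (Real.exp_pos _), ← h1]
    exact (ContinuousLinearMap.le_opNorm _ _).trans (by gcongr; exact hK _)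
  have hlim : Tendsto (fun t : ℝ => Real.exp (-t) * (K * ‖d‖)) atTop (𝓝 0) := by
    simpa using (Real.tendsto_exp_neg_atTop_nhds_zero).mul_const (K * ‖d‖)
  have : ‖d‖ ≤ 0 := ge_of_tendsto hlim (by
    filter_upwards [eventually_ge_atTop 0] with t ht using hb t ht)
  exact norm_le_zero_iff.1 this

/-- The generation theorem: `-A` generates a bounded strongly continuous semigroup. The operators
`S t` with `t < 0` are chosen to be the identity, so that joint continuity holds on `ℝ × X`. -/
theorem IsResolventSeq.exists_semigroup {A : X →ₗ.[ℝ] X} {K : ℝ} {R : ℕ → X →L[ℝ] X}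
    (hR : IsResolventSeq A K R) :
    ∃ S : ℝ → X →L[ℝ] X, IsSemigroupOfNeg S A ∧ Continuous fun p : ℝ × X => S p.1 p.2 := by
  choose S hS using hR.exists_limit
  have hSt : ∀ t, 0 ≤ t → ∀ x, Tendsto (fun n : ℕ => NormedSpace.exp (t • yosida R n) x) atTop
      (𝓝 (S t x)) := by
    intro t ht x
    have := hS t x
    rwa [max_eq_left ht] at this
  have hSmax : ∀ t, S t = S (max t 0) := by
    intro t
    ext x
    refine tendsto_nhds_unique (hS t x) ?_
    have := hS (max t 0) x
    rwa [max_eq_left (le_max_right t 0)] at this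
  have hK0 := hR.nonneg
  have hK : ∀ t, ‖S t‖ ≤ K := by
    intro t
    refine ContinuousLinearMap.opNorm_le_bound _ hK0 fun x => ?_
    refine le_of_tendsto (hS t x).norm (Eventually.of_forall fun n => ?_)
    exact (ContinuousLinearMap.le_opNorm _ _).trans
      (by gcongr; exact hR.norm_exp_le n (le_max_right t 0))
  have h0 : S 0 = ContinuousLinearMap.id ℝ X := by
    ext x
    refine tendsto_nhds_unique (hSt 0 le_rfl x) ?_
    simp [NormedSpace.exp_zero]
  have hadd : ∀ s t : ℝ, 0 ≤ s → 0 ≤ t → S (s + t) = S s ∘L S t := by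
    intro s t hs ht
    ext x
    refine tendsto_nhds_unique (hSt (s + t) (add_nonneg hs ht) x) ?_
    simp only [exp_add_smul, mul_apply_eq_comp, ContinuousLinearMap.comp_apply]
    have h1 : Tendsto (fun n : ℕ => NormedSpace.exp (s • yosida R n)
        (NormedSpace.exp (t • yosida R n) x - S t x)) atTop (𝓝 0) := by
      refine squeeze_zero_norm (a := fun n : ℕ => K * ‖NormedSpace.exp (t • yosida R n) x - S t x‖)
        (fun n => ?_) ?_
      · exact (ContinuousLinearMap.le_opNorm _ _).trans (by gcongr; exact hR.norm_exp_le n hs)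
      · simpa using (tendsto_iff_norm_sub_tendsto_zero.1 (hSt t ht x)).const_mul K
    have h2 := h1.add (hSt s hs (S t x))
    rw [zero_add] at h2
    exact h2.congr fun n => by rw [map_sub]; abel
  have hcont : ∀ x, Continuous fun t => S t x := by
    intro x
    have hon : ∀ a : ℝ, 0 ≤ a → ContinuousOn (fun t => S t x) (Set.Icc 0 a) := by
      intro a ha
      refine ((hR.uniformCauchySeqOn x ha).tendstoUniformlyOn_of_tendsto
        fun t ht => hSt t ht.1 x).continuousOn (Frequently.of_forall fun n => ?_)
      exact ((continuous_exp_smul _).clm_apply continuous_const).continuousOn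
    have hIci : ContinuousOn (fun t => S t x) (Set.Ici 0) := by
      intro t ht
      have ht' : (0 : ℝ) ≤ t := ht
      refine (hon (t + 1) (by linarith) t ⟨ht, by linarith⟩).mono_of_mem_nhdsWithin ?_
      rw [← Set.Ici_inter_Iic]
      exact inter_mem_nhdsWithin _ (Iic_mem_nhds (by linarith))
    have : (fun t => S t x) = (fun t => S t x) ∘ fun t => max t 0 := by
      funext t
      exact congrArg (fun T : X →L[ℝ] X => T x) (hSmax t)
    rw [this]
    exact hIci.comp_continuous (by fun_prop) fun t => le_max_right t 0
  have hint : ∀ x y : X, (x, y) ∈ A.graph → ∀ t : ℝ, 0 ≤ t →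
      S t x - x = - ∫ s in (0 : ℝ)..t, S s y := by
    intro x y hxy t ht
    have h1 : ∀ n : ℕ, NormedSpace.exp (t • yosida R n) x - x =
        ∫ s in (0 : ℝ)..t, NormedSpace.exp (s • yosida R n) (yosida R n x) := by
      intro n
      have hd : ∀ s, HasDerivAt (fun s : ℝ => NormedSpace.exp (s • yosida R n) x)
          (NormedSpace.exp (s • yosida R n) (yosida R n x)) s := by
        intro s
        have := (hasDerivAt_exp_smul_const (𝕂 := ℝ) (yosida R n) s).clm_apply (hasDerivAt_const s x)
        simpa using this
      have hc : Continuous fun s : ℝ => NormedSpace.exp (s • yosida R n) (yosida R n x) := by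
        exact (continuous_exp_smul _).clm_apply continuous_const
      rw [intervalIntegral.integral_eq_sub_of_hasDerivAt (fun s _ => hd s) (hc.intervalIntegrable _ _)]
      simp [NormedSpace.exp_zero]
    have h2 : Tendsto (fun n : ℕ => NormedSpace.exp (t • yosida R n) x - x) atTop
        (𝓝 (S t x - x)) := (hSt t ht x).sub_const x
    refine tendsto_nhds_unique h2 ?_
    rw [← intervalIntegral.integral_neg]
    simp only [h1]
    refine intervalIntegral.tendsto_integral_filter_of_dominated_convergence
      (fun _ => K * (K * ‖y‖)) ?_ ?_ intervalIntegrable_const ?_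
    · refine Eventually.of_forall fun n => Continuous.aestronglyMeasurable ?_
      exact (continuous_exp_smul _).clm_apply continuous_const
    · refine Eventually.of_forall fun n => Eventually.of_forall fun s hs => ?_
      rw [Set.uIoc_of_le ht] at hs
      refine (ContinuousLinearMap.le_opNorm _ _).trans ?_
      rw [hR.yosida_apply n hxy, norm_neg]
      gcongr
      · exact hR.norm_exp_le n hs.1.le
      · exact (ContinuousLinearMap.le_opNorm _ _).trans (by gcongr; exact hR.norm_smul_le n)
    · refine Eventually.of_forall fun s hs => ?_
      rw [Set.uIoc_of_le ht] at hs
      have h3 : Tendsto (fun n : ℕ => NormedSpace.exp (s • yosida R n) (yosida R n x - (-y))) atTop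
          (𝓝 0) := by
        refine squeeze_zero_norm (a := fun n : ℕ => K * ‖yosida R n x - (-y)‖) (fun n => ?_) ?_
        · exact (ContinuousLinearMap.le_opNorm _ _).trans
            (by gcongr; exact hR.norm_exp_le n hs.1.le)
        · simpa using (tendsto_iff_norm_sub_tendsto_zero.1 (hR.tendsto_yosida hxy)).const_mul K
      have h4 := h3.sub (hSt s hs.1.le y)
      rw [zero_sub] at h4
      exact h4.congr fun n => by rw [map_sub, map_neg]; abel
  have hgen : ∀ x y : X, (x, y) ∈ A.graph →
      Tendsto (fun t : ℝ => t⁻¹ • (S t x - x)) (𝓝[>] 0) (𝓝 (-y)) := by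
    intro x y hxy
    have hd : HasDerivAt (fun t : ℝ => - ∫ s in (0 : ℝ)..t, S s y) (-(S 0 y)) 0 :=
      ((hcont y).integral_hasStrictDerivAt 0 0).hasDerivAt.neg
    rw [h0] at hd
    have h1 := (hasDerivAt_iff_tendsto_slope_zero.1 hd).mono_left
      (nhdsWithin_mono (0 : ℝ) (fun t (ht : (0 : ℝ) < t) => ht.ne'))
    refine h1.congr' ?_
    filter_upwards [self_mem_nhdsWithin] with t ht
    rw [hint x y hxy t (le_of_lt ht)]
    simp
  refine ⟨S, ⟨h0, hadd, fun x => (hcont x).continuousOn, fun x y => ⟨hgen x y, fun hxy => ?_⟩⟩,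
    continuous_uncurry_of_norm_le hK hcont⟩
  -- `x' = (1 + A)⁻¹ (x + y)` lies in the domain, and `x - x'` is an eigenvector to the eigenvalue `1`
  have hRes := hR.isResolvent 0
  simp only [CharP.cast_eq_zero, zero_add] at hRes
  set x' := R 0 (x + y) with hx'
  have hg' : (x', x + y - x') ∈ A.graph := by
    have := hRes.mem_graph (x + y)
    rwa [one_smul] at this
  have hd : x - x' = 0 := by
    refine eq_zero_of_semigroup_eigenvector hK h0 hadd hcont ?_
    have := hxy.sub (hgen _ _ hg')
    have e : -y - -(x + y - x') = x - x' := by abel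
    rw [e] at this
    exact this.congr fun t => by rw [← smul_sub, map_sub]; congr 1; abel
  have hxx : x' = x := (sub_eq_zero.1 hd).symm
  rw [hxx, add_sub_cancel_left] at hg'
  exact hg'

theorem exists_semigroup {A : X →ₗ.[ℝ] X} (hA : IsSectorial A)
    (hangle : sectorialityAngle A < Real.pi / 2) :
    ∃ S : ℝ → X →L[ℝ] X, IsSemigroupOfNeg S A ∧ Continuous fun p : ℝ × X => S p.1 p.2 := by
  obtain ⟨K, h⟩ := exists_powerBounded_resolvents hA hangle
  choose R hR hK using fun n : ℕ => h (n + 1) (by positivity)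
  exact IsResolventSeq.exists_semigroup ⟨hR, hK, (exists_halfPlane_bound hA hangle).2.1⟩

end Generation

/-! ### The `γ`-norm -/

section GammaNorm

variable {H X : Type*} [NormedAddCommGroup H] [InnerProductSpace ℝ H]
  [NormedAddCommGroup X] [NormedSpace ℝ X]

lemma lintegral_gaussian_sum_sq {N : ℕ} (c : Fin N → ℝ) :
    ∫⁻ g : Fin N → ℝ, ‖∑ n, g n * c n‖ₑ ^ 2 ∂(Measure.pi fun _ : Fin N => gaussianReal 0 1) =
      ENNReal.ofReal (∑ n, c n ^ 2) := by
  set μ := Measure.pi fun _ : Fin N => gaussianReal 0 1 with hμ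
  have hid : ∀ n, MemLp (fun y : ℝ => y * c n) 2 (gaussianReal 0 1) := fun n =>
    (memLp_id_gaussianReal' 2 (by simp)).mul_const (c n)
  have hmem : ∀ n, MemLp (fun g : Fin N → ℝ => g n * c n) 2 μ := fun n =>
    (hid n).comp_measurePreserving (measurePreserving_eval _ n)
  have hsum : MemLp (fun g : Fin N → ℝ => ∑ n, g n * c n) 2 μ := memLp_finsetSum _ fun n _ => hmem n
  have hmean : ∫ g, ∑ n, g n * c n ∂μ = 0 := by
    rw [integral_finsetSum _ fun n _ => (hmem n).integrable (by norm_num)]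
    refine Finset.sum_eq_zero fun n _ => ?_
    rw [integral_mul_const]
    have h1 : ∫ g : Fin N → ℝ, g n ∂μ = ∫ y, y ∂(gaussianReal 0 1) :=
      integral_comp_eval (μ := fun _ : Fin N => gaussianReal 0 1) (i := n) (f := fun y : ℝ => y)
        aestronglyMeasurable_id
    rw [h1, integral_id_gaussianReal, zero_mul]
  have hvar := variance_sum_pi (μ := fun _ : Fin N => gaussianReal 0 1)
    (X := fun n y => y * c n) hid
  have hfun : (∑ i : Fin N, fun g : Fin N → ℝ => g i * c i) = fun g => ∑ n, g n * c n := by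
    ext g; simp
  rw [hfun, variance_of_integral_eq_zero hsum.aestronglyMeasurable.aemeasurable hmean] at hvar
  have hv1 : ∀ n, Var[fun y : ℝ => y * c n; gaussianReal 0 1] = c n ^ 2 := by
    intro n
    have h := variance_mul_const (c n) (fun y : ℝ => y) (gaussianReal 0 1)
    rw [h, variance_fun_id_gaussianReal]
    simp
  simp only [hv1] at hvar
  rw [← hvar, ofReal_integral_eq_lintegral_ofReal hsum.integrable_sq
    (Eventually.of_forall fun _ => sq_nonneg _)]
  refine lintegral_congr fun g => ?_
  rw [Real.enorm_eq_ofReal_abs, ← ENNReal.ofReal_pow (abs_nonneg _), sq_abs]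

lemma gaussianSumENorm_smul {N : ℕ} (c : Fin N → ℝ) (x : X) :
    gaussianSumENorm (fun n => c n • x) = ENNReal.ofReal (∑ n, c n ^ 2) ^ (1 / 2 : ℝ) * ‖x‖ₑ := by
  have h : ∀ g : Fin N → ℝ, ‖∑ n, g n • c n • x‖ₑ ^ 2 = ‖∑ n, g n * c n‖ₑ ^ 2 * ‖x‖ₑ ^ 2 := by
    intro g
    rw [← mul_pow, ← enorm_smul, Finset.sum_smul]
    simp only [mul_smul]
  have hp : (‖x‖ₑ ^ 2) ^ (1 / 2 : ℝ) = ‖x‖ₑ := by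
    rw [← ENNReal.rpow_natCast, ← ENNReal.rpow_mul]; norm_num
  simp only [gaussianSumENorm, h]
  rw [lintegral_mul_const' _ _ (by simp), lintegral_gaussian_sum_sq,
    ENNReal.mul_rpow_of_nonneg _ _ (by norm_num), hp]

lemma gaussianSumENorm_add_le {N : ℕ} (x y : Fin N → X) :
    gaussianSumENorm (x + y) ≤ gaussianSumENorm x + gaussianSumENorm y := by
  have hm : ∀ z : Fin N → X, AEMeasurable (fun g : Fin N → ℝ => ‖∑ n, g n • z n‖ₑ)
      (Measure.pi fun _ : Fin N => gaussianReal 0 1) := fun z =>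
    Continuous.aemeasurable (by fun_prop)
  have h := ENNReal.lintegral_Lp_add_le (hm x) (hm y) (p := 2) (by norm_num)
  simp only [Pi.add_apply, ENNReal.rpow_ofNat] at h
  refine le_trans ?_ h
  unfold gaussianSumENorm
  gcongr with g
  simp only [Pi.add_apply, smul_add, Finset.sum_add_distrib]
  exact enorm_add_le _ _

lemma gammaENorm_add_le (S T : H →L[ℝ] X) :
    gammaENorm (S + T) ≤ gammaENorm S + gammaENorm T := by
  refine iSup_le fun N => iSup_le fun h => iSup_le fun hh => ?_
  refine (gaussianSumENorm_add_le (fun n => S (h n)) fun n => T (h n)).trans ?_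
  gcongr
  · exact le_iSup₂_of_le N h (le_iSup_of_le hh le_rfl)
  · exact le_iSup₂_of_le N h (le_iSup_of_le hh le_rfl)

lemma gammaENorm_neg (T : H →L[ℝ] X) : gammaENorm (-T) = gammaENorm T := by
  simp [gammaENorm, gaussianSumENorm]

lemma gammaENorm_zero : gammaENorm (0 : H →L[ℝ] X) = 0 := by
  simp [gammaENorm, gaussianSumENorm]

lemma gammaENorm_sub_le (S T : H →L[ℝ] X) :
    gammaENorm (S - T) ≤ gammaENorm S + gammaENorm T := by
  rw [sub_eq_add_neg, ← gammaENorm_neg T]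
  exact gammaENorm_add_le _ _

lemma gammaENorm_sum_le {ι : Type*} (s : Finset ι) (T : ι → H →L[ℝ] X) :
    gammaENorm (∑ i ∈ s, T i) ≤ ∑ i ∈ s, gammaENorm (T i) :=
  Finset.le_sum_of_subadditive _ gammaENorm_zero.le gammaENorm_add_le _ _

/-- The `γ`-norm dominates the operator norm. -/
lemma enorm_apply_le (T : H →L[ℝ] X) (h : H) : ‖T h‖ₑ ≤ ‖h‖ₑ * gammaENorm T := by
  rcases eq_or_ne h 0 with rfl | hne
  · simp
  have hn : ‖h‖ ≠ 0 := norm_ne_zero_iff.2 hne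
  set e : H := ‖h‖⁻¹ • h with he
  have hon : Orthonormal ℝ fun _ : Fin 1 => e := by
    refine ⟨fun _ => ?_, fun i j hij => absurd (Subsingleton.elim i j) hij⟩
    rw [he, norm_smul, norm_inv, norm_norm, inv_mul_cancel₀ hn]
  have h1 : ‖T e‖ₑ ≤ gammaENorm T := by
    refine le_trans ?_ (le_iSup₂_of_le 1 (fun _ => e) (le_iSup_of_le hon le_rfl))
    have := gaussianSumENorm_smul (fun _ : Fin 1 => (1 : ℝ)) (T e)
    simp only [one_smul] at this
    rw [this]
    simp
  have h2 : T h = ‖h‖ • T e := by rw [← map_smul, he, smul_inv_smul₀ hn]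
  rw [h2, enorm_smul, enorm_norm]
  gcongr

/-- The operator `h ⊗ x`. -/
abbrev tensorOp (h : H) (x : X) : H →L[ℝ] X := (innerSL ℝ h).smulRight x

/-- Bessel's inequality gives the cross norm estimate. -/
lemma gammaENorm_tensorOp_le (h : H) (x : X) : gammaENorm (tensorOp h x) ≤ ‖h‖ₑ * ‖x‖ₑ := by
  refine iSup_le fun N => iSup_le fun e => iSup_le fun he => ?_
  have h1 := gaussianSumENorm_smul (fun n => inner ℝ h (e n)) x
  have h2 : (fun n => tensorOp h x (e n)) = fun n => inner ℝ h (e n) • x := by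
    funext n; simp [tensorOp]
  rw [h2, h1]
  gcongr
  have h3 : ∑ n, inner ℝ h (e n) ^ 2 ≤ ‖h‖ ^ 2 := by
    have := he.sum_inner_products_le h (s := Finset.univ)
    simpa [real_inner_comm] using this
  calc ENNReal.ofReal (∑ n, inner ℝ h (e n) ^ 2) ^ (1 / 2 : ℝ)
      ≤ ENNReal.ofReal (‖h‖ ^ 2) ^ (1 / 2 : ℝ) := by gcongr
    _ = ‖h‖ₑ := by
      rw [ENNReal.ofReal_pow (norm_nonneg _), ofReal_norm, ← ENNReal.rpow_natCast,
        ← ENNReal.rpow_mul]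
      norm_num

/-- The operators `∑ h' ⊗ x'` with `h'` and `x'` from dense sets are dense in `γ(H, X)`. -/
lemma MemGamma.exists_approx {T : H →L[ℝ] X} (hT : MemGamma T) {s : Set H} (hs : Dense s)
    {t : Set X} (ht : Dense t) {ε : ℝ≥0∞} (hε : 0 < ε) :
    ∃ (N : ℕ) (h : Fin N → H) (x : Fin N → X), (∀ n, h n ∈ s) ∧ (∀ n, x n ∈ t) ∧
      gammaENorm (T - ∑ n, tensorOp (h n) (x n)) < ε := by
  obtain ⟨R, ⟨N, h₀, x₀, -, rfl⟩, hR⟩ := hT (ε / 2) (ENNReal.half_pos hε.ne')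
  obtain ⟨δ, hδ, hδε⟩ : ∃ δ : ℝ, 0 < δ ∧ ENNReal.ofReal δ * N ≤ ε / 2 := by
    rcases eq_or_ne ε ⊤ with rfl | htop
    · exact ⟨1, one_pos, by rw [ENNReal.top_div_of_ne_top (by simp)]; exact le_top⟩
    · have hr : 0 < (ε / 2).toReal :=
        ENNReal.toReal_pos (ENNReal.half_pos hε.ne').ne' (ENNReal.div_ne_top htop (by simp))
      refine ⟨(ε / 2).toReal / (N + 1), by positivity, ?_⟩
      rw [← ENNReal.ofReal_natCast, ← ENNReal.ofReal_mul (by positivity)]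
      refine ENNReal.ofReal_le_of_le_toReal ?_
      rw [div_mul_eq_mul_div, div_le_iff₀ (by positivity)]
      gcongr
      linarith
  have key : ∀ n, ∃ p : H × X, p.1 ∈ s ∧ p.2 ∈ t ∧
      gammaENorm (tensorOp (h₀ n) (x₀ n) - tensorOp p.1 p.2) ≤ ENNReal.ofReal δ := by
    intro n
    let F : H × X → ℝ := fun p => ‖h₀ n - p.1‖ * ‖x₀ n‖ + ‖p.1‖ * ‖x₀ n - p.2‖
    have hF : Continuous F := by fun_prop
    obtain ⟨p, hpF, hp⟩ := (hs.prod ht).inter_open_nonempty {p | F p < δ}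
      (isOpen_lt hF continuous_const) ⟨(h₀ n, x₀ n), by simpa [F] using hδ⟩
    refine ⟨p, hp.1, hp.2, ?_⟩
    have e : tensorOp (h₀ n) (x₀ n) - tensorOp p.1 p.2 =
        tensorOp (h₀ n - p.1) (x₀ n) + tensorOp p.1 (x₀ n - p.2) := by
      ext z
      simp only [tensorOp, sub_apply, add_apply, ContinuousLinearMap.smulRight_apply, map_sub]
      module
    rw [e]
    refine (gammaENorm_add_le _ _).trans ?_
    refine (add_le_add (gammaENorm_tensorOp_le _ _) (gammaENorm_tensorOp_le _ _)).trans ?_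
    simp only [← ofReal_norm]
    rw [← ENNReal.ofReal_mul (norm_nonneg _), ← ENNReal.ofReal_mul (norm_nonneg _),
      ← ENNReal.ofReal_add (by positivity) (by positivity)]
    exact ENNReal.ofReal_le_ofReal (le_of_lt hpF)
  choose p hp1 hp2 hp3 using key
  refine ⟨N, fun n => (p n).1, fun n => (p n).2, hp1, hp2, ?_⟩
  have e : T - ∑ n, tensorOp (p n).1 (p n).2 = (T - ∑ n, tensorOp (h₀ n) (x₀ n)) +
      ∑ n, (tensorOp (h₀ n) (x₀ n) - tensorOp (p n).1 (p n).2) := by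
    rw [Finset.sum_sub_distrib]; abel
  rw [e]
  refine (gammaENorm_add_le _ _).trans_lt ?_
  rw [← ENNReal.add_halves ε]
  refine ENNReal.add_lt_add_of_lt_of_le ?_ hR ?_
  · refine ne_top_of_le_ne_top (b := ENNReal.ofReal δ * N) (by finiteness) ?_
    refine (gammaENorm_sum_le _ _).trans ((Finset.sum_le_sum fun n _ => hp3 n).trans ?_)
    simp [mul_comm]
  · refine le_trans ?_ hδε
    refine (gammaENorm_sum_le _ _).trans ((Finset.sum_le_sum fun n _ => hp3 n).trans ?_)
    simp [mul_comm]

end GammaNorm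

/-! ### Test functions -/

/-- `L²` classes of functions in `C_c^∞((0, ∞))`. -/
def smoothHalf : Submodule ℝ L2Half where
  carrier := {h | ∃ ψ : ℝ → ℝ, ContDiff ℝ ∞ ψ ∧ HasCompactSupport ψ ∧ tsupport ψ ⊆ Set.Ioi 0 ∧
    h =ᵐ[volume.restrict (Set.Ici 0)] ψ}
  add_mem' := by
    rintro f g ⟨φ, h1, h2, h3, h4⟩ ⟨ψ, g1, g2, g3, g4⟩
    refine ⟨φ + ψ, h1.add g1, h2.add g2, (tsupport_add φ ψ).trans (Set.union_subset h3 g3), ?_⟩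
    exact (Lp.coeFn_add f g).trans (h4.add g4)
  zero_mem' := ⟨0, contDiff_const, HasCompactSupport.zero, by simp [tsupport], Lp.coeFn_zero _ _ _⟩
  smul_mem' := by
    rintro c f ⟨φ, h1, h2, h3, h4⟩
    refine ⟨c • φ, h1.const_smul c, h2.smul_left (f := fun _ => c), ?_, ?_⟩
    · exact (tsupport_smul_subset_right (fun _ => c) φ).trans h3
    · exact (Lp.coeFn_smul c f).trans (h4.const_smul c)

lemma dense_smoothHalf : Dense (smoothHalf : Set L2Half) := by
  rw [Submodule.dense_iff_topologicalClosure_eq_top, Submodule.topologicalClosure_eq_top_iff,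
    Submodule.eq_bot_iff]
  intro f hf
  rw [Submodule.mem_orthogonal] at hf
  have hmem : MemLp f 2 (volume.restrict (Set.Ici (0 : ℝ))) := Lp.memLp f
  have hloc : LocallyIntegrable f (volume.restrict (Set.Ici (0 : ℝ))) :=
    hmem.locallyIntegrable (by norm_num)
  have h0 : ∀ᵐ x ∂(volume.restrict (Set.Ici (0 : ℝ))), x ∈ Set.Ioi (0 : ℝ) → f x = 0 := by
    refine isOpen_Ioi.ae_eq_zero_of_integral_contDiff_smul_eq_zero (hloc.locallyIntegrableOn _) ?_
    intro ψ h1 h2 h3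
    have hψ : MemLp ψ 2 (volume.restrict (Set.Ici (0 : ℝ))) :=
      h1.continuous.memLp_of_hasCompactSupport h2
    have := hf (hψ.toLp ψ) ⟨ψ, h1, h2, h3, hψ.coeFn_toLp⟩
    rw [L2.inner_def] at this
    refine Eq.trans (integral_congr_ae ?_) this
    filter_upwards [hψ.coeFn_toLp] with x hx
    rw [hx]
    simp [mul_comm]
  rw [Lp.eq_zero_iff_ae_eq_zero]
  have hpos : ∀ᵐ x ∂(volume.restrict (Set.Ici (0 : ℝ))), x ∈ Set.Ioi (0 : ℝ) := by
    rw [← restrict_Ioi_eq_restrict_Ici]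
    exact ae_restrict_mem measurableSet_Ioi
  filter_upwards [h0, hpos] with x hx hx'
  exact hx hx'

section TestFunctions

variable {X : Type*} [NormedAddCommGroup X] [NormedSpace ℝ X] {A : X →ₗ.[ℝ] X}

lemma IsTestFunction.continuous {f : ℝ → A.domain} (hf : IsTestFunction A f) :
    Continuous fun t => (f t : X) := hf.smooth.continuous

lemma IsTestFunction.sub {f g : ℝ → A.domain} (hf : IsTestFunction A f) (hg : IsTestFunction A g) :
    IsTestFunction A (fun t => f t - g t) where
  smooth := by simpa using hf.smooth.sub hg.smooth
  smooth_apply := by simpa [LinearPMap.map_sub] using hf.smooth_apply.sub hg.smooth_apply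
  compact_support := by simpa using! hf.compact_support.sub hg.compact_support
  support_subset := by
    have := (tsupport_sub (fun t => (f t : X)) fun t => (g t : X)).trans
      (Set.union_subset hf.support_subset hg.support_subset)
    simpa using! this

lemma Induces.sub {E : Type*} [MeasurableSpace E] {ν : Measure E} {f g : E → X}
    {S T : Lp ℝ 2 ν →L[ℝ] X} (hf : Induces ν f S) (hg : Induces ν g T) :
    Induces ν (fun t => f t - g t) (S - T) := by
  refine ⟨hf.1.sub hg.1, fun F hF hν => ?_⟩
  obtain ⟨h1, h2⟩ := hf.2 F hF hν
  obtain ⟨h3, h4⟩ := hg.2 F hF hν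
  refine ⟨h1.sub h3, ?_⟩
  rw [integral_sub h1 h3, sub_apply, h2, h4]

/-- Each finite sum `∑ ψ ⊗ y` with `ψ ∈ C_c^∞((0, ∞))` and `y ∈ D(A)` is induced by a test
function. -/
lemma exists_isTestFunction [CompleteSpace X] {N : ℕ} {h : Fin N → L2Half} {x : Fin N → X}
    (hh : ∀ n, h n ∈ smoothHalf) (hx : ∀ n, x n ∈ A.domain) :
    ∃ f : ℝ → A.domain, IsTestFunction A f ∧
      Induces (volume.restrict (Set.Ici 0)) (fun t => (f t : X)) (∑ n, tensorOp (h n) (x n)) := by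
  choose ψ h1 h2 h3 h4 using hh
  let y : Fin N → A.domain := fun n => ⟨x n, hx n⟩
  let f : ℝ → A.domain := fun t => ∑ n, ψ n t • y n
  have hf : ∀ t, (f t : X) = ∑ n, ψ n t • x n := fun t => by simp [f, y]
  have hAf : ∀ t, A (f t) = ∑ n, ψ n t • A (y n) := fun t => by
    change A.toFun (∑ n, ψ n t • y n) = _
    rw [map_sum]
    simp only [map_smul]
    rfl
  have hcont : Continuous fun t => (f t : X) := by
    simp only [hf]
    exact continuous_finsetSum _ fun n _ => (h1 n).continuous.smul continuous_const
  have hK : IsCompact (⋃ n, tsupport (ψ n)) := isCompact_iUnion fun n => h2 n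
  have hzero : ∀ t, t ∉ ⋃ n, tsupport (ψ n) → (f t : X) = 0 := by
    intro t ht
    rw [hf]
    refine Finset.sum_eq_zero fun n _ => ?_
    rw [image_eq_zero_of_notMem_tsupport (fun hn => ht (Set.mem_iUnion.2 ⟨n, hn⟩)), zero_smul]
  have hcs : HasCompactSupport fun t => (f t : X) := HasCompactSupport.intro hK hzero
  have hint : Integrable (fun t => (f t : X)) (volume.restrict (Set.Ici (0 : ℝ))) :=
    hcont.integrable_of_hasCompactSupport hcs
  refine ⟨f, ⟨?_, ?_, hcs, ?_⟩, hint.aestronglyMeasurable, fun F hF hν => ⟨hint.integrableOn, ?_⟩⟩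
  · simp only [hf]
    exact ContDiff.sum fun n _ => (h1 n).smul contDiff_const
  · simp only [hAf]
    exact ContDiff.sum fun n _ => (h1 n).smul contDiff_const
  · refine (closure_minimal (fun t ht => ?_) hK.isClosed).trans (Set.iUnion_subset h3)
    by_contra hcon
    exact ht (hzero t hcon)
  · simp only [hf]
    rw [integral_finsetSum]
    · rw [sum_apply]
      refine Finset.sum_congr rfl fun n _ => ?_
      rw [integral_smul_const, ContinuousLinearMap.smulRight_apply, innerSL_apply_apply,
        real_inner_comm, L2.inner_indicatorConstLp_one]
      congr 1
      exact integral_congr_ae (ae_restrict_of_ae (h4 n))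
    · intro n _
      refine Integrable.integrableOn ?_
      exact ((h1 n).continuous.smul continuous_const).integrable_of_hasCompactSupport
        ((h2 n).smul_right)

end TestFunctions

/-! ### Operators on `L²(ℝ₊)` evaluated on intervals -/

section Interval

variable {X : Type*} [NormedAddCommGroup X] [NormedSpace ℝ X]

lemma restrict_Ici_Ioc_ne_top (t : ℝ) : (volume.restrict (Set.Ici (0 : ℝ))) (Set.Ioc 0 t) ≠ ⊤ :=
  ne_top_of_le_ne_top (by simp) (Measure.restrict_apply_le (Set.Ici 0) (Set.Ioc 0 t))

/-- The indicator function of `(0, t]` as an element of `L²(ℝ₊)`. -/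
def indicatorIoc (t : ℝ) : L2Half :=
  indicatorConstLp 2 (measurableSet_Ioc (a := (0 : ℝ)) (b := t)) (restrict_Ici_Ioc_ne_top t) 1

lemma restrict_Ici_restrict_Ioc (t : ℝ) :
    (volume.restrict (Set.Ici (0 : ℝ))).restrict (Set.Ioc 0 t) = volume.restrict (Set.Ioc 0 t) :=
  Measure.restrict_restrict_of_subset fun _ hs => hs.1.le

lemma enorm_indicatorIoc {t : ℝ} (ht : 0 ≤ t) :
    ‖indicatorIoc t‖ₑ = ENNReal.ofReal (Real.sqrt t) := by
  rw [← ofReal_norm, indicatorIoc, norm_indicatorConstLp (by simp) (by simp)]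
  have h : (volume.restrict (Set.Ici (0 : ℝ))).real (Set.Ioc 0 t) = t := by
    rw [← measureReal_restrict_apply_univ, restrict_Ici_restrict_Ioc]
    simp [ht]
  rw [h]
  simp [Real.sqrt_eq_rpow]

lemma Induces.intervalIntegrable {f : ℝ → X} {T : L2Half →L[ℝ] X}
    (hf : Induces (volume.restrict (Set.Ici 0)) f T) {t : ℝ} (ht : 0 ≤ t) :
    IntervalIntegrable f volume 0 t := by
  rw [intervalIntegrable_iff_integrableOn_Ioc_of_le ht]
  have := (hf.2 (Set.Ioc 0 t) measurableSet_Ioc (restrict_Ici_Ioc_ne_top t)).1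
  rwa [IntegrableOn, restrict_Ici_restrict_Ioc] at this

lemma Induces.apply_indicatorIoc {f : ℝ → X} {T : L2Half →L[ℝ] X}
    (hf : Induces (volume.restrict (Set.Ici 0)) f T) {t : ℝ} (ht : 0 ≤ t) :
    T (indicatorIoc t) = ∫ s in (0 : ℝ)..t, f s := by
  rw [intervalIntegral.integral_of_le ht, ← restrict_Ici_restrict_Ioc]
  exact (hf.2 (Set.Ioc 0 t) measurableSet_Ioc (restrict_Ici_Ioc_ne_top t)).2

lemma integral_pairing (T : L2Half →L[ℝ] X) (φ : X →L[ℝ] ℝ) {t : ℝ} (ht : 0 ≤ t) :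
    ∫ s in (0 : ℝ)..t, pairing T φ s = φ (T (indicatorIoc t)) := by
  have h1 : inner ℝ (pairing T φ) (indicatorIoc t) = φ (T (indicatorIoc t)) := by
    rw [pairing, InnerProductSpace.toDual_symm_apply]; rfl
  rw [← h1, real_inner_comm, indicatorIoc, L2.inner_indicatorConstLp_one,
    restrict_Ici_restrict_Ioc, intervalIntegral.integral_of_le ht]

end Interval

/-! ### The inhomogeneous problem for test functions -/

section Convolution

variable {X : Type*} [NormedAddCommGroup X] [NormedSpace ℝ X] [CompleteSpace X]
  {A : X →ₗ.[ℝ] X} {S : ℝ → X →L[ℝ] X}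

omit [CompleteSpace X] in
lemma continuous_convolution (hS : Continuous fun p : ℝ × X => S p.1 p.2) {f : ℝ → X}
    (hf : Continuous f) : Continuous (convolution S f) := by
  refine intervalIntegral.continuous_parametric_intervalIntegral_of_continuous
    (f := fun t s => S (t - s) (f s)) ?_ continuous_id
  exact hS.comp ((continuous_fst.sub continuous_snd).prodMk (hf.comp continuous_snd))

omit [CompleteSpace X] in
lemma convolution_sub (hS : Continuous fun p : ℝ × X => S p.1 p.2) {f g : ℝ → X}
    (hf : Continuous f) (hg : Continuous g) (t : ℝ) :
    convolution S (fun s => f s - g s) t = convolution S f t - convolution S g t := by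
  have h : ∀ {k : ℝ → X}, Continuous k → IntervalIntegrable (fun s => S (t - s) (k s)) volume 0 t :=
    fun hk => (hS.comp ((continuous_const.sub continuous_id).prodMk hk)).intervalIntegrable _ _
  rw [convolution, convolution, convolution, ← intervalIntegral.integral_sub (h hf) (h hg)]
  simp only [map_sub]

lemma convolution_add_time (hSA : IsSemigroupOfNeg S A)
    (hS : Continuous fun p : ℝ × X => S p.1 p.2) {f : ℝ → X} (hf : Continuous f) {t h : ℝ}
    (ht : 0 ≤ t) (hh : 0 ≤ h) :
    convolution S f (t + h) =
      S h (convolution S f t) + ∫ s in t..t + h, S (t + h - s) (f s) := by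
  have hint : ∀ r a b : ℝ, IntervalIntegrable (fun s => S (r - s) (f s)) volume a b :=
    fun r a b => (hS.comp ((continuous_const.sub continuous_id).prodMk hf)).intervalIntegrable _ _
  rw [convolution, convolution, ← intervalIntegral.integral_add_adjacent_intervals
    (hint (t + h) 0 t) (hint (t + h) t (t + h)), ← (S h).intervalIntegral_comp_comm (hint t 0 t)]
  congr 1
  refine intervalIntegral.integral_congr fun s hs => ?_
  rw [Set.uIcc_of_le ht] at hs
  have := hSA.map_add h (t - s) hh (sub_nonneg.2 hs.2)
  rw [show t + h - s = h + (t - s) by ring]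
  rw [this]; rfl

/-- Where `u = S * f` lies in the domain of `A`, its right derivative is `f - A u`. -/
lemma hasDerivWithinAt_convolution (hSA : IsSemigroupOfNeg S A)
    (hS : Continuous fun p : ℝ × X => S p.1 p.2) {f : ℝ → X} (hf : Continuous f) {t : ℝ}
    (ht : 0 ≤ t) {y : X} (hy : (convolution S f t, y) ∈ A.graph) :
    HasDerivWithinAt (convolution S f) (f t - y) (Set.Ioi t) t := by
  rw [hasDerivWithinAt_iff_tendsto_slope' Set.self_notMem_Ioi]
  have hshift : Tendsto (fun r : ℝ => r - t) (𝓝[>] t) (𝓝[>] 0) := by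
    refine tendsto_nhdsWithin_iff.2 ⟨?_, ?_⟩
    · have : Continuous fun r : ℝ => r - t := by fun_prop
      simpa using (this.tendsto t).mono_left nhdsWithin_le_nhds
    · filter_upwards [self_mem_nhdsWithin] with r hr using sub_pos.2 (show t < r from hr)
  have h1 := ((hSA.generator _ _).1 hy).comp hshift
  have h2 : Tendsto (fun r : ℝ => (r - t)⁻¹ • ∫ s in t..r, S (r - s) (f s)) (𝓝[>] t) (𝓝 (f t)) := by
    have hG : Continuous fun p : ℝ × ℝ => S (p.1 - p.2) (f p.2) :=
      hS.comp ((continuous_fst.sub continuous_snd).prodMk (hf.comp continuous_snd))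
    have hGt : S (t - t) (f t) = f t := by rw [sub_self, hSA.map_zero]; rfl
    rw [Metric.tendsto_nhds]
    intro ε hε
    obtain ⟨δ, hδ, hball⟩ := Metric.continuousAt_iff.1 (hG.continuousAt (x := (t, t))) (ε / 2)
      (by positivity)
    have hmem : Set.Ioo t (t + δ) ∈ 𝓝[>] t := Ioo_mem_nhdsGT (by linarith)
    filter_upwards [hmem] with r hr
    have hrt : 0 < r - t := sub_pos.2 hr.1
    have hi : IntervalIntegrable (fun s => S (r - s) (f s)) volume t r :=
      (hG.comp (continuous_const.prodMk continuous_id)).intervalIntegrable _ _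
    have h3 : ‖∫ s in t..r, (S (r - s) (f s) - f t)‖ ≤ ε / 2 * |r - t| := by
      refine intervalIntegral.norm_integral_le_of_norm_le_const fun s hs => ?_
      rw [Set.uIoc_of_le hr.1.le] at hs
      have hd : dist ((r, s) : ℝ × ℝ) (t, t) < δ := by
        rw [Prod.dist_eq, Real.dist_eq, Real.dist_eq, abs_of_pos hrt, abs_of_pos (sub_pos.2 hs.1)]
        exact max_lt (by linarith [hr.2]) (by linarith [hr.2, hs.2])
      have := hball hd
      rw [hGt, dist_eq_norm] at this
      exact this.le
    rw [intervalIntegral.integral_sub hi intervalIntegrable_const,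
      intervalIntegral.integral_const] at h3
    rw [dist_eq_norm]
    have h4 : (r - t)⁻¹ • (∫ s in t..r, S (r - s) (f s)) - f t =
        (r - t)⁻¹ • ((∫ s in t..r, S (r - s) (f s)) - (r - t) • f t) := by
      rw [smul_sub, inv_smul_smul₀ hrt.ne']
    rw [h4, norm_smul, norm_inv, Real.norm_of_nonneg hrt.le]
    rw [abs_of_pos hrt] at h3
    calc _ ≤ (r - t)⁻¹ * (ε / 2 * (r - t)) := by gcongr
      _ = ε / 2 := by field_simp
      _ < ε := by linarith
  have h3 := h2.add h1
  rw [← sub_eq_add_neg] at h3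
  refine h3.congr' ?_
  filter_upwards [self_mem_nhdsWithin] with r hr
  have hr' : t < r := hr
  have h4 := convolution_add_time hSA hS hf ht (sub_nonneg.2 hr'.le)
  rw [add_sub_cancel] at h4
  rw [slope_def_module, h4, Function.comp_apply, ← smul_add]
  congr 1
  abel

/-- The identity `u(t) = ∫₀ᵗ (f - A u)` for `u = S * f`, in terms of the operators `T` and `V` induced
by `f` and `A u`. -/
lemma convolution_eq_apply (hSA : IsSemigroupOfNeg S A)
    (hS : Continuous fun p : ℝ × X => S p.1 p.2) {f v : ℝ → X} (hf : Continuous f)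
    (hv : ∀ t : ℝ, 0 ≤ t → (convolution S f t, v t) ∈ A.graph) {T V : L2Half →L[ℝ] X}
    (hT : Induces (volume.restrict (Set.Ici 0)) f T)
    (hV : Induces (volume.restrict (Set.Ici 0)) v V) {t : ℝ} (ht : 0 ≤ t) :
    convolution S f t = T (indicatorIoc t) - V (indicatorIoc t) := by
  have hTV := hT.sub hV
  rw [← sub_apply, hTV.apply_indicatorIoc ht,
    intervalIntegral.integral_eq_sub_of_hasDeriv_right (f := convolution S f)
      (continuous_convolution hS hf).continuousOn ?_ (hTV.intervalIntegrable ht)]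
  · simp [convolution]
  · intro s hs
    rw [min_eq_left ht, max_eq_right ht] at hs
    exact hasDerivWithinAt_convolution hSA hS hf hs.1.le (hv s hs.1.le)

lemma isWeakSolution_convolution (hSA : IsSemigroupOfNeg S A)
    (hS : Continuous fun p : ℝ × X => S p.1 p.2) {f v : ℝ → X} (hf : Continuous f)
    (hv : ∀ t : ℝ, 0 ≤ t → (convolution S f t, v t) ∈ A.graph) {T V : L2Half →L[ℝ] X}
    (hT : Induces (volume.restrict (Set.Ici 0)) f T)
    (hV : Induces (volume.restrict (Set.Ici 0)) v V) :
    IsWeakSolution A T (convolution S f) where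
  locally_integrable t := (continuous_convolution hS hf).integrableOn_Icc
  initial := by simp [convolution]
  equation := by
    intro t ht φ ψ hφ
    have h1 : ∫ s in (0 : ℝ)..t, ψ (convolution S f s) = φ (V (indicatorIoc t)) := by
      rw [hV.apply_indicatorIoc ht.le, ← φ.intervalIntegral_comp_comm (hV.intervalIntegrable ht.le)]
      refine intervalIntegral.integral_congr fun s hs => ?_
      rw [Set.uIcc_of_le ht.le] at hs
      obtain ⟨a, ha, hav⟩ := (LinearPMap.mem_graph_iff _).1 (hv s hs.1)
      exact (congrArg ψ ha).symm.trans ((hφ a).symm.trans (congrArg φ hav))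
    rw [h1, integral_pairing T φ ht.le, convolution_eq_apply hSA hS hf hv hT hV ht.le, map_sub]
    abel

end Convolution

/-! ### Uniqueness of weak solutions -/

section Uniqueness

variable {X : Type*} [NormedAddCommGroup X] [NormedSpace ℝ X]
  {A : X →ₗ.[ℝ] X} {S : ℝ → X →L[ℝ] X}

/-- A closed operator is determined by its adjoint: by the Hahn–Banach theorem in `X × X`, a pair
that satisfies all weak identities belongs to the graph. -/
lemma mem_graph_of_forall_isAdjointPair (hA : A.IsClosed) {x y : X}
    (h : ∀ φ ψ : X →L[ℝ] ℝ, IsAdjointPair A φ ψ → φ y = ψ x) : (x, y) ∈ A.graph := by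
  by_contra hcon
  obtain ⟨l, u, hl, hlu⟩ := geometric_hahn_banach_closed_point (E := X × X)
    (s := (A.graph : Set (X × X))) (x := (x, y)) A.graph.convex hA hcon
  have hu : 0 < u := by simpa using hl 0 A.graph.zero_mem
  have hzero : ∀ a ∈ A.graph, l a = 0 := by
    intro a ha
    by_contra hne
    have := hl ((u / l a) • a) (A.graph.smul_mem _ ha)
    rw [map_smul, smul_eq_mul, div_mul_cancel₀ _ hne] at this
    exact lt_irrefl _ this
  have hadj : IsAdjointPair A (l ∘L ContinuousLinearMap.inr ℝ X X)
      (-(l ∘L ContinuousLinearMap.inl ℝ X X)) := by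
    intro a
    have := hzero _ (A.mem_graph a)
    have e : ((a : X), A a) = ContinuousLinearMap.inl ℝ X X (a : X) +
        ContinuousLinearMap.inr ℝ X X (A a) := by simp
    rw [e, map_add] at this
    simp only [ContinuousLinearMap.comp_apply, neg_apply]
    linarith
  have := h _ _ hadj
  have e : (x, y) = ContinuousLinearMap.inl ℝ X X x + ContinuousLinearMap.inr ℝ X X y := by simp
  rw [e, map_add] at hlu
  simp only [ContinuousLinearMap.comp_apply, neg_apply] at this
  linarith

/-- Classical uniqueness: `s ↦ S(t - s) w(s)` is constant if `w' = -A w`. -/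
lemma eq_zero_of_hasDerivAt_neg (hSA : IsSemigroupOfNeg S A)
    (hS : Continuous fun p : ℝ × X => S p.1 p.2) {w w' : ℝ → X} (h0 : w 0 = 0)
    (hw : ∀ t, HasDerivAt w (w' t) t) (hA : ∀ t : ℝ, 0 ≤ t → (w t, -w' t) ∈ A.graph) {t : ℝ}
    (ht : 0 ≤ t) : w t = 0 := by
  have hwc : Continuous w := continuous_iff_continuousAt.2 fun s => (hw s).continuousAt
  let q : ℝ → X := fun s => S (t - s) (w s)
  have hq : ContinuousOn q (Set.Icc 0 t) :=
    (hS.comp ((continuous_const.sub continuous_id).prodMk hwc)).continuousOn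
  have hder : ∀ s ∈ Set.Ico 0 t, HasDerivWithinAt q 0 (Set.Ici s) s := by
    intro s hs
    rw [← hasDerivWithinAt_Ioi_iff_Ici, hasDerivWithinAt_iff_tendsto_slope' Set.self_notMem_Ioi]
    have hshift : Tendsto (fun r : ℝ => r - s) (𝓝[>] s) (𝓝[>] 0) := by
      refine tendsto_nhdsWithin_iff.2 ⟨?_, ?_⟩
      · have : Continuous fun r : ℝ => r - s := by fun_prop
        simpa using (this.tendsto s).mono_left nhdsWithin_le_nhds
      · filter_upwards [self_mem_nhdsWithin] with r hr using sub_pos.2 (show s < r from hr)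
    have h1 := ((hSA.generator _ _).1 (hA s hs.1)).comp hshift
    have h2 := (hasDerivWithinAt_iff_tendsto_slope' Set.self_notMem_Ioi).1
      ((hw s).hasDerivWithinAt (s := Set.Ioi s))
    have h3 := h2.sub h1
    rw [neg_neg, sub_self] at h3
    have h4 : Tendsto (fun r : ℝ => t - r) (𝓝[>] s) (𝓝 (t - s)) := by
      have : Continuous fun r : ℝ => t - r := by fun_prop
      exact (this.tendsto s).mono_left nhdsWithin_le_nhds
    have h5 := (hS.tendsto (t - s, (0 : X))).comp (h4.prodMk_nhds h3)
    rw [map_zero] at h5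
    refine h5.congr' ?_
    filter_upwards [Ioc_mem_nhdsGT hs.2] with r hr
    have hr' : s < r := hr.1
    have h6 : S (t - s) (w s) = S (t - r) (S (r - s) (w s)) := by
      have := hSA.map_add (t - r) (r - s) (sub_nonneg.2 hr.2) (sub_nonneg.2 hr'.le)
      rw [sub_add_sub_cancel] at this
      rw [this]; rfl
    simp only [Function.comp_apply, slope_def_module, q]
    rw [h6, ← map_sub, ← map_smul, ← smul_sub]
    congr 2
    abel
  have := constant_of_has_deriv_right_zero hq hder t ⟨ht, le_rfl⟩
  simpa [q, h0, hSA.map_zero] using this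

variable [CompleteSpace X]

/-- The second primitive of the difference of two weak solutions solves `w' = -A w` classically. -/
theorem IsWeakSolution.eqOn (hSA : IsSemigroupOfNeg S A)
    (hS : Continuous fun p : ℝ × X => S p.1 p.2) (hA : A.IsClosed) {T : L2Half →L[ℝ] X}
    {u v : ℝ → X} (hu : IsWeakSolution A T u) (hv : IsWeakSolution A T v) :
    Set.EqOn v u (Set.Ici 0) := by
  have hint : ∀ {k : ℝ → X}, IsWeakSolution A T k → ∀ t : ℝ, 0 ≤ t →
      IntervalIntegrable k volume 0 t := by
    intro k hk t ht
    rw [intervalIntegrable_iff_integrableOn_Icc_of_le ht]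
    exact hk.locally_integrable t
  -- Extending the difference by zero to negative times makes its primitives global functions.
  let d : ℝ → X := (Set.Ici (0 : ℝ)).indicator fun s => v s - u s
  have hd : ∀ t, 0 ≤ t → d t = v t - u t := fun t ht => Set.indicator_of_mem (Set.mem_Ici.2 ht) _
  have hdint : ∀ a b : ℝ, IntervalIntegrable d volume a b := by
    have key : ∀ t : ℝ, IntervalIntegrable d volume 0 t := by
      intro t
      rcases le_total 0 t with ht | ht
      · refine ((hint hv t ht).sub (hint hu t ht)).congr fun s hs => ?_
        rw [Set.uIoc_of_le ht] at hs
        exact (hd s hs.1.le).symm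
      · refine IntervalIntegrable.symm ?_
        rw [intervalIntegrable_iff_integrableOn_Ioo_of_le ht]
        refine (integrableOn_zero (μ := volume) (s := Set.Ioo t 0)).congr_fun (fun s hs => ?_)
          measurableSet_Ioo
        exact (Set.indicator_of_notMem (fun h => absurd hs.2 (not_lt.2 h)) _).symm
    exact fun a b => (key a).symm.trans (key b)
  have hdw : ∀ t : ℝ, 0 ≤ t → ∀ φ ψ : X →L[ℝ] ℝ, IsAdjointPair A φ ψ →
      φ (d t) = -∫ s in (0 : ℝ)..t, ψ (d s) := by
    intro t ht φ ψ hφ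
    rcases ht.eq_or_lt with rfl | ht'
    · simp [hd, hu.initial, hv.initial]
    have h1 := hu.equation t ht' φ ψ hφ
    have h2 := hv.equation t ht' φ ψ hφ
    have h3 : ∫ s in (0 : ℝ)..t, ψ (d s) =
        (∫ s in (0 : ℝ)..t, ψ (v s)) - ∫ s in (0 : ℝ)..t, ψ (u s) := by
      rw [ψ.intervalIntegral_comp_comm (hint hv t ht), ψ.intervalIntegral_comp_comm (hint hu t ht),
        ψ.intervalIntegral_comp_comm (hdint 0 t), ← map_sub,
        ← intervalIntegral.integral_sub (hint hv t ht) (hint hu t ht)]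
      congr 1
      refine intervalIntegral.integral_congr fun s hs => ?_
      rw [Set.uIcc_of_le ht] at hs
      exact hd s hs.1
    rw [hd t ht, map_sub]
    linarith
  let W : ℝ → X := fun t => ∫ s in (0 : ℝ)..t, d s
  have hWc : Continuous W := intervalIntegral.continuous_primitive hdint 0
  let W₂ : ℝ → X := fun t => ∫ s in (0 : ℝ)..t, W s
  have hW₂ : ∀ t, HasDerivAt W₂ (W t) t := fun t => (hWc.integral_hasStrictDerivAt 0 t).hasDerivAt
  have hWd : ∀ t : ℝ, 0 ≤ t → (W t, -d t) ∈ A.graph := by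
    intro t ht
    refine mem_graph_of_forall_isAdjointPair hA fun φ ψ hφ => ?_
    rw [map_neg, hdw t ht φ ψ hφ, neg_neg, ψ.intervalIntegral_comp_comm (hdint 0 t)]
  have hW₂W : ∀ t : ℝ, 0 ≤ t → (W₂ t, -W t) ∈ A.graph := by
    intro t ht
    refine mem_graph_of_forall_isAdjointPair hA fun φ ψ hφ => ?_
    rw [map_neg, ← φ.intervalIntegral_comp_comm (hdint 0 t),
      ← ψ.intervalIntegral_comp_comm (hWc.intervalIntegrable 0 t), ← intervalIntegral.integral_neg]
    refine intervalIntegral.integral_congr fun s hs => ?_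
    rw [Set.uIcc_of_le ht] at hs
    rw [hdw s hs.1 φ ψ hφ, neg_neg, ψ.intervalIntegral_comp_comm (hdint 0 s)]
  have h0 : ∀ t : ℝ, 0 ≤ t → W₂ t = 0 := fun t ht =>
    eq_zero_of_hasDerivAt_neg hSA hS (by simp [W₂]) hW₂ hW₂W ht
  have hW0 : ∀ t : ℝ, 0 ≤ t → W t = 0 := fun t ht =>
    neg_eq_zero.1 (A.graph_fst_eq_zero_snd (hW₂W t ht) (h0 t ht))
  intro t ht
  have hd0 := neg_eq_zero.1 (A.graph_fst_eq_zero_snd (hWd t ht) (hW0 t ht))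
  rw [hd t ht] at hd0
  exact sub_eq_zero.1 hd0

end Uniqueness

/-! ### Existence by approximation -/

section Existence

variable {X : Type*} [NormedAddCommGroup X] [NormedSpace ℝ X] [CompleteSpace X]
  {A : X →ₗ.[ℝ] X} {S : ℝ → X →L[ℝ] X}

/-- The a priori estimate for test functions: `u(t)` is the value of the operator induced by
`u' = f - A u` at the indicator function of `(0, t]`, whose `L²` norm is `√t`. -/
lemma enorm_convolution_le (hSA : IsSemigroupOfNeg S A)
    (hS : Continuous fun p : ℝ × X => S p.1 p.2) {f v : ℝ → X} (hf : Continuous f)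
    (hv : ∀ t : ℝ, 0 ≤ t → (convolution S f t, v t) ∈ A.graph) {T V : L2Half →L[ℝ] X}
    (hT : Induces (volume.restrict (Set.Ici 0)) f T)
    (hV : Induces (volume.restrict (Set.Ici 0)) v V) {C : ℝ≥0}
    (hC : gammaENorm V ≤ C * gammaENorm T) {t a : ℝ} (ht : t ∈ Set.Icc 0 a) :
    ‖convolution S f t‖ₑ ≤ ((1 + C : ℝ≥0) : ℝ≥0∞) * ENNReal.ofReal (Real.sqrt a) * gammaENorm T := by
  rw [convolution_eq_apply hSA hS hf hv hT hV ht.1, ← sub_apply]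
  refine (enorm_apply_le _ _).trans ?_
  rw [enorm_indicatorIoc ht.1]
  have h1 : gammaENorm (T - V) ≤ ((1 + C : ℝ≥0) : ℝ≥0∞) * gammaENorm T := by
    refine (gammaENorm_sub_le _ _).trans ?_
    push_cast
    rw [add_mul, one_mul]
    gcongr
  have h2 : ENNReal.ofReal (Real.sqrt t) ≤ ENNReal.ofReal (Real.sqrt a) :=
    ENNReal.ofReal_le_ofReal (Real.sqrt_le_sqrt ht.2)
  calc _ ≤ ENNReal.ofReal (Real.sqrt a) * (((1 + C : ℝ≥0) : ℝ≥0∞) * gammaENorm T) := by gcongr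
    _ = _ := by ring

omit [CompleteSpace X] in
/-- Weak solutions converge if the data converge in the `γ`-norm and the solutions converge
uniformly on bounded intervals. -/
lemma IsWeakSolution.of_tendsto {T : L2Half →L[ℝ] X} {Tn : ℕ → L2Half →L[ℝ] X} {u : ℝ → X}
    {un : ℕ → ℝ → X} (hsol : ∀ n, IsWeakSolution A (Tn n) (un n)) (hun : ∀ n, Continuous (un n))
    (hu : Continuous u) (hT : Tendsto (fun n => gammaENorm (Tn n - T)) atTop (𝓝 0))
    (hlim : ∀ a : ℝ, TendstoUniformlyOn un u atTop (Set.Icc 0 a)) : IsWeakSolution A T u where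
  locally_integrable t := hu.integrableOn_Icc
  initial := by
    refine tendsto_nhds_unique ((hlim 0).tendsto_at ⟨le_rfl, le_rfl⟩) ?_
    simp only [(hsol _).initial]
    exact tendsto_const_nhds
  equation := by
    intro t ht φ ψ hφ
    have h1 : Tendsto (fun n => φ (un n t)) atTop (𝓝 (φ (u t))) :=
      (φ.continuous.tendsto _).comp ((hlim t).tendsto_at ⟨ht.le, le_rfl⟩)
    have h2 : Tendsto (fun n => ∫ s in (0 : ℝ)..t, ψ (un n s)) atTop
        (𝓝 (∫ s in (0 : ℝ)..t, ψ (u s))) := by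
      refine intervalIntegral.tendsto_integral_filter_of_dominated_convergence
        (fun s => ‖ψ‖ * (1 + ‖u s‖)) ?_ ?_ ?_ ?_
      · exact Eventually.of_forall fun n => (ψ.continuous.comp (hun n)).aestronglyMeasurable
      · filter_upwards [Metric.tendstoUniformlyOn_iff.1 (hlim t) 1 one_pos] with n hn
        refine Eventually.of_forall fun s hs => ?_
        rw [Set.uIoc_of_le ht.le] at hs
        refine (ψ.le_opNorm _).trans ?_
        gcongr
        have := hn s ⟨hs.1.le, hs.2⟩
        rw [dist_eq_norm, norm_sub_rev] at this
        have h3 := norm_le_norm_add_norm_sub (u s) (un n s)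
        rw [norm_sub_rev] at h3
        linarith
      · exact Continuous.intervalIntegrable (by fun_prop) _ _
      · refine Eventually.of_forall fun s hs => ?_
        rw [Set.uIoc_of_le ht.le] at hs
        exact (ψ.continuous.tendsto _).comp ((hlim t).tendsto_at ⟨hs.1.le, hs.2⟩)
    have h3 : Tendsto (fun n => φ (Tn n (indicatorIoc t))) atTop (𝓝 (φ (T (indicatorIoc t)))) := by
      refine (φ.continuous.tendsto _).comp ?_
      rw [tendsto_iff_edist_tendsto_0]
      have h4 : Tendsto (fun n => ‖indicatorIoc t‖ₑ * gammaENorm (Tn n - T)) atTop (𝓝 0) := by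
        simpa using ENNReal.Tendsto.const_mul hT (Or.inr enorm_ne_top)
      refine tendsto_of_tendsto_of_tendsto_of_le_of_le tendsto_const_nhds h4 (fun _ => zero_le)
        fun n => ?_
      beta_reduce
      rw [edist_eq_enorm_sub, ← sub_apply]
      exact enorm_apply_le _ _
    rw [integral_pairing T φ ht.le]
    refine tendsto_nhds_unique (h1.add h2) (h3.congr fun n => ?_)
    rw [← integral_pairing (Tn n) φ ht.le, (hsol n).equation t ht φ ψ hφ]

/-- Existence with the norm estimate, by density of the test functions and the estimate for
differences of their solutions. -/
theorem exists_isWeakSolution (hSA : IsSemigroupOfNeg S A)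
    (hS : Continuous fun p : ℝ × X => S p.1 p.2) (hdense : Dense (A.domain : Set X)) {C : ℝ≥0}
    (hC : ∀ f : ℝ → A.domain, IsTestFunction A f →
      ∀ Tf : L2Half →L[ℝ] X, Induces (volume.restrict (Set.Ici 0)) (fun t => (f t : X)) Tf →
        ∃ (v : ℝ → X) (Tv : L2Half →L[ℝ] X),
          (∀ t : ℝ, 0 ≤ t → (convolution S (fun s => (f s : X)) t, v t) ∈ A.graph) ∧
          Induces (volume.restrict (Set.Ici 0)) v Tv ∧ MemGamma Tv ∧
          gammaENorm Tv ≤ C * gammaENorm Tf)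
    {T : L2Half →L[ℝ] X} (hT : MemGamma T) :
    ∃ u : ℝ → X, IsWeakSolution A T u ∧ Continuous u ∧ ∀ a : ℝ, ∀ t ∈ Set.Icc 0 a,
      ‖u t‖ₑ ≤ ((1 + C : ℝ≥0) : ℝ≥0∞) * ENNReal.ofReal (Real.sqrt a) * gammaENorm T := by
  have happrox : ∀ n : ℕ, ∃ (f : ℝ → A.domain) (Tf : L2Half →L[ℝ] X), IsTestFunction A f ∧
      Induces (volume.restrict (Set.Ici 0)) (fun t => (f t : X)) Tf ∧
      gammaENorm (T - Tf) < ((n : ℝ≥0∞) + 1)⁻¹ := by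
    intro n
    obtain ⟨N, h, x, hh, hx, hlt⟩ := hT.exists_approx dense_smoothHalf hdense
      (ε := ((n : ℝ≥0∞) + 1)⁻¹) (by simp)
    obtain ⟨f, hf, hfT⟩ := exists_isTestFunction hh hx
    exact ⟨f, _, hf, hfT, hlt⟩
  choose f Tf hf hfT hlt using happrox
  set K : ℝ≥0∞ := ((1 + C : ℝ≥0) : ℝ≥0∞) with hK
  let un : ℕ → ℝ → X := fun n => convolution S fun s => (f n s : X)
  have hunc : ∀ n, Continuous (un n) := fun n => continuous_convolution hS (hf n).continuous
  have hε : Tendsto (fun n : ℕ => ((n : ℝ≥0∞) + 1)⁻¹) atTop (𝓝 0) := by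
    have := ENNReal.tendsto_inv_nat_nhds_zero.comp (tendsto_add_atTop_nat 1)
    refine this.congr fun n => ?_
    simp
  have hTf : Tendsto (fun n => gammaENorm (Tf n - T)) atTop (𝓝 0) := by
    refine tendsto_of_tendsto_of_tendsto_of_le_of_le tendsto_const_nhds hε (fun _ => zero_le)
      fun n => ?_
    beta_reduce
    rw [← gammaENorm_neg, neg_sub]
    exact (hlt n).le
  have hdiff : ∀ (n m : ℕ) (a : ℝ), ∀ t ∈ Set.Icc 0 a, edist (un n t) (un m t) ≤
      K * ENNReal.ofReal (Real.sqrt a) * (gammaENorm (Tf n - T) + gammaENorm (Tf m - T)) := by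
    intro n m a t ht
    have hsub := (hfT n).sub (hfT m)
    obtain ⟨v, V, hv, hV, -, hle⟩ := hC _ ((hf n).sub (hf m)) (Tf n - Tf m) hsub
    have h1 := enorm_convolution_le hSA hS ((hf n).sub (hf m)).continuous hv hsub hV hle ht
    have h2 := convolution_sub hS (hf n).continuous (hf m).continuous t
    simp only [AddSubgroupClass.coe_sub] at h1
    rw [h2] at h1
    rw [edist_eq_enorm_sub]
    refine h1.trans ?_
    gcongr
    rw [← sub_sub_sub_cancel_right (Tf n) (Tf m) T]
    exact gammaENorm_sub_le _ _
  have hcauchy : ∀ a : ℝ, UniformCauchySeqOn un atTop (Set.Icc 0 a) := by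
    intro a
    have hb : Tendsto (fun p : ℕ × ℕ => K * ENNReal.ofReal (Real.sqrt a) *
        (gammaENorm (Tf p.1 - T) + gammaENorm (Tf p.2 - T))) (atTop ×ˢ atTop) (𝓝 0) := by
      have := (hTf.comp tendsto_fst).add (hTf.comp (tendsto_snd (f := (atTop : Filter ℕ))))
      rw [add_zero] at this
      simpa using ENNReal.Tendsto.const_mul (a := K * ENNReal.ofReal (Real.sqrt a)) this
        (Or.inr (by finiteness))
    intro U hU
    obtain ⟨ε, hε, hεU⟩ := mem_uniformity_edist.1 hU
    filter_upwards [hb.eventually (gt_mem_nhds hε)] with p hp t ht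
    exact hεU ((hdiff p.1 p.2 a t ht).trans_lt hp)
  have hex : ∀ t : ℝ, ∃ y, Tendsto (fun n => un n (max t 0)) atTop (𝓝 y) := fun t =>
    cauchySeq_tendsto_of_complete ((hcauchy (max t 0)).cauchySeq ⟨le_max_right t 0, le_rfl⟩)
  choose u hu using hex
  have hu' : ∀ t : ℝ, 0 ≤ t → Tendsto (fun n => un n t) atTop (𝓝 (u t)) := by
    intro t ht
    have := hu t
    rwa [max_eq_left ht] at this
  have hlim : ∀ a : ℝ, TendstoUniformlyOn un u atTop (Set.Icc 0 a) := fun a =>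
    (hcauchy a).tendstoUniformlyOn_of_tendsto fun t ht => hu' t ht.1
  have hucont : Continuous u := by
    have hIci : ContinuousOn u (Set.Ici 0) := by
      intro t ht
      have ht' : (0 : ℝ) ≤ t := ht
      have hon : ContinuousOn u (Set.Icc 0 (t + 1)) :=
        (hlim (t + 1)).continuousOn (Frequently.of_forall fun n => (hunc n).continuousOn)
      refine (hon t ⟨ht, by linarith⟩).mono_of_mem_nhdsWithin ?_
      rw [← Set.Ici_inter_Iic]
      exact inter_mem_nhdsWithin _ (Iic_mem_nhds (by linarith))
    have : u = u ∘ fun t => max t 0 := by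
      funext t
      exact tendsto_nhds_unique (hu t) (hu' _ (le_max_right t 0))
    rw [this]
    exact hIci.comp_continuous (by fun_prop) fun t => le_max_right t 0
  have hsol : ∀ n, IsWeakSolution A (Tf n) (un n) := by
    intro n
    obtain ⟨v, V, hv, hV, -, -⟩ := hC _ (hf n) (Tf n) (hfT n)
    exact isWeakSolution_convolution hSA hS (hf n).continuous hv (hfT n) hV
  refine ⟨u, IsWeakSolution.of_tendsto hsol hunc hucont hTf hlim, hucont, fun a t ht => ?_⟩
  have hbound : ∀ n, ‖un n t‖ₑ ≤
      K * ENNReal.ofReal (Real.sqrt a) * (gammaENorm T + gammaENorm (Tf n - T)) := by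
    intro n
    obtain ⟨v, V, hv, hV, -, hle⟩ := hC _ (hf n) (Tf n) (hfT n)
    refine (enorm_convolution_le hSA hS (hf n).continuous hv (hfT n) hV hle ht).trans ?_
    gcongr
    calc gammaENorm (Tf n) = gammaENorm (T + (Tf n - T)) := by rw [add_sub_cancel]
      _ ≤ _ := gammaENorm_add_le _ _
  have hr : Tendsto (fun n => K * ENNReal.ofReal (Real.sqrt a) *
      (gammaENorm T + gammaENorm (Tf n - T))) atTop
      (𝓝 (K * ENNReal.ofReal (Real.sqrt a) * gammaENorm T)) := by
    have h1 := (tendsto_const_nhds (x := gammaENorm T)).add hTf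
    rw [add_zero] at h1
    exact ENNReal.Tendsto.const_mul h1 (Or.inr (by finiteness))
  exact le_of_tendsto_of_tendsto' (hu' t ht.1).enorm hr hbound

end Existence

end GammaReg

end

theorem proposition3p2 {X : Type*} [NormedAddCommGroup X] [NormedSpace ℝ X] [CompleteSpace X]
    (A : X →ₗ.[ℝ] X) (hA : GammaReg.IsSectorial A)
    (hangle : GammaReg.sectorialityAngle A < Real.pi / 2)
    (hreg : GammaReg.HasMaximalGammaRegularity A) :
    ∃ C : ℝ≥0, ∀ f : GammaReg.L2Half →L[ℝ] X, GammaReg.MemGamma f →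
      ∃ u : ℝ → X, GammaReg.IsWeakSolution A f u ∧
        (∀ v : ℝ → X, GammaReg.IsWeakSolution A f v → Set.EqOn v u (Set.Ici 0)) ∧
        ∀ T : ℝ, 0 ≤ T → ContinuousOn u (Set.Icc 0 T) ∧
          ∀ t ∈ Set.Icc (0 : ℝ) T,
            ‖u t‖ₑ ≤ C * ENNReal.ofReal (Real.sqrt T) * GammaReg.gammaENorm f := by
  obtain ⟨S, hSA, hS⟩ := GammaReg.exists_semigroup hA hangle
  obtain ⟨hclosed, hdense, -⟩ := GammaReg.exists_halfPlane_bound hA hangle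
  obtain ⟨C, hC⟩ := hreg S hSA
  refine ⟨1 + C, fun f hf => ?_⟩
  obtain ⟨u, hu, hcont, hle⟩ := GammaReg.exists_isWeakSolution hSA hS hdense hC hf
  exact ⟨u, hu, fun v hv => hu.eqOn hSA hS hclosed hv,
    fun T _ => ⟨hcont.continuousOn, hle T⟩⟩
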